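/- Let $\mathbb{Z}\wr\mathbb{Z}$ be the group of pairs $(f,x)$, where $x\in\mathbb{Z}$ and $f:\mathbb{Z}\to\mathbb{Z}$ has finite support, with product $(f,x)(g,y)=(z\mapsto f(z)+g(z-x),\,x+y)$. Equip it with the word metric $d$ of the generators $(0,\pm1)$ and $(\pm\delta_0,0)$, that is, with the shortest path metric of the corresponding Cayley graph. For a metric space $(X,d_X)$, $p>0$, and a stationary reversible Markov chain $(Z_t)_{t\ge 0}$ on a finite state space $\{1,\dots,n\}$ with a map $h:\{1,\dots,n\}\to X$, consider the inequality $$\mathbb{E}\big[d_X(h(Z_t),h(Z_0))^p\big]\le K^p\,t\,\mathbb{E}\big[d_X(h(Z_1),h(Z_0))^p\big]\quad\text{for all } t\in\mathbb{N}.\qquad(*)$$ For $D>0$, $X$ has $D$-bounded increment Markov type $p$ with constant $K$ if $(*)$ holds for all such chains and maps with $d_X(h(Z_0),h(Z_1))\le D$ almost surely. A graph with its shortest path metric has edge Markov type $p$ if there is $K>0$ such that $(*)$ holds for all such chains and maps for which $h(Z_0)$ and $h(Z_1)$ are almost surely joined by an edge. $X$ has Enflo type $p$ if there is $K>0$ such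 that for all $n\in\mathbb{N}$ and $h:\{-1,1\}^n\to X$, $$\mathbb{E}\big[d_X(h(\varepsilon),h(-\varepsilon))^p\big]\le K^p\sum_{j=1}^n\mathbb{E}\big[d_X(h(\varepsilon),h(\varepsilon^{(j)}))^p\big],$$ where $\varepsilon$ is uniform on $\{-1,1\}^n$ and $\varepsilon^{(j)}$ is $\varepsilon$ with its $j$-th coordinate negated. Then: 1. For every $0<\alpha<\frac23$ there is $C=C(\alpha)>0$ such that for every $D>0$, $\mathbb{Z}\wr\mathbb{Z}$ has $D$-bounded increment Markov type $2\alpha$ with constant $C\,D^{(1-\alpha)/\alpha}$; that is, $\mathbb{E}[d(h(Z_t),h(Z_0))^{2\alpha}]\le C^{2\alpha}D^{2(1-\alpha)}\,t\,\mathbb{E}[d(h(Z_1),h(Z_0))^{2\alpha}]$ for all such chains, maps and all $t\in\mathbb{N}$. 2. The Cayley graph of $\mathbb{Z}\wr\mathbb{Z}$ has edge Markov type $p$ for every $0<p<\frac43$. 3. $\mathbb{Z}\wr\mathbb{Z}$ does not have Enflo type $p$ for any $p>1$. -/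

import Mathlib

open MeasureTheory
open scoped BigOperators

/-- Every Cayley graph of a group with respect to a generating set is connected. -/
theorem mulCayley_connected {G : Type*} [Group G] {S : Set G}
    (hS : Subgroup.closure S = ⊤) : (SimpleGraph.mulCayley S).Connected := by
  have key : ∀ g : G, ∀ u : G, (SimpleGraph.mulCayley S).Reachable u (u * g) := by
    intro g
    have hg : g ∈ Subgroup.closure S := hS ▸ Subgroup.mem_top g
    induction hg using Subgroup.closure_induction with
    | mem x hx =>
      intro u
      by_cases h : u = u * x
      · rw [← h]
      · exact SimpleGraph.Adj.reachable
          ((SimpleGraph.mulCayley_adj' S u (u * x)).2 ⟨h, x, hx, Or.inl rfl⟩)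
    | one => intro u; rw [mul_one]
    | mul x y _ _ hx hy =>
      intro u
      rw [← mul_assoc]
      exact (hx u).trans (hy (u * x))
    | inv x _ hx =>
      intro u
      have := hx (u * x⁻¹)
      rw [inv_mul_cancel_right] at this
      exact this.symm
  have : Nonempty G := ⟨1⟩
  refine ⟨fun u v => ?_⟩
  simpa using key (u⁻¹ * v) u

/-- The (restricted) wreath product of `G` and `H`: pairs `(f, x)` with `f : H → G` of finite
support and `x : H`. -/
@[ext]
structure WreathProduct (G H : Type*) [Group G] where
  /-- the finitely supported function `H → G` -/
  lamp : H → G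
  /-- the element of `H` -/
  pos : H
  finite_support : (Function.mulSupport lamp).Finite

namespace WreathProduct

variable {G H : Type*} [Group G] [Group H]

theorem finite_mulSupport_shift {g : H → G} (hg : (Function.mulSupport g).Finite) (x : H) :
    (Function.mulSupport fun z => g (x⁻¹ * z)).Finite :=
  hg.preimage ((mul_right_injective x⁻¹).injOn)

/-- `(f, x) (g, y) = (z ↦ f z * g (x⁻¹ z), x y)`. -/
instance : Mul (WreathProduct G H) where
  mul a b :=
    { lamp := fun z => a.lamp z * b.lamp (a.pos⁻¹ * z)
      pos := a.pos * b.pos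
      finite_support :=
        (a.finite_support.union (finite_mulSupport_shift b.finite_support a.pos)).subset
          (Function.mulSupport_mul _ _) }

instance : One (WreathProduct G H) where
  one := { lamp := fun _ => 1, pos := 1, finite_support := by simp }

instance : Inv (WreathProduct G H) where
  inv a :=
    { lamp := fun z => (a.lamp (a.pos * z))⁻¹
      pos := a.pos⁻¹
      finite_support := by
        have h := finite_mulSupport_shift a.finite_support a.pos⁻¹
        simpa [Function.mulSupport] using h }

@[simp] theorem mul_lamp (a b : WreathProduct G H) (z : H) :
    (a * b).lamp z = a.lamp z * b.lamp (a.pos⁻¹ * z) := rfl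
@[simp] theorem mul_pos (a b : WreathProduct G H) : (a * b).pos = a.pos * b.pos := rfl
@[simp] theorem one_lamp (z : H) : (1 : WreathProduct G H).lamp z = 1 := rfl
@[simp] theorem one_pos : (1 : WreathProduct G H).pos = 1 := rfl
@[simp] theorem inv_lamp (a : WreathProduct G H) (z : H) :
    (a⁻¹).lamp z = (a.lamp (a.pos * z))⁻¹ := rfl
@[simp] theorem inv_pos (a : WreathProduct G H) : (a⁻¹).pos = a.pos⁻¹ := rfl

instance : Group (WreathProduct G H) :=
  Group.ofLeftAxioms
    (fun a b c => by
      ext z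
      · simp [mul_assoc]
      · simp [mul_assoc])
    (fun a => by
      ext z
      · simp
      · simp)
    (fun a => by
      ext z
      · simp
      · simp)

/-- The element `(1, t)`. -/
def move (t : H) : WreathProduct G H where
  lamp := fun _ => 1
  pos := t
  finite_support := by simp

variable [DecidableEq H]

/-- The element `(s δ_x, 1)`, where `s δ_x` takes the value `s` at `x` and `1` elsewhere. -/
def single (x : H) (s : G) : WreathProduct G H where
  lamp := Pi.mulSingle x s
  pos := 1
  finite_support := (Set.finite_singleton x).subset Pi.mulSupport_mulSingle_subset

/-- The canonical generators `(1, t)`, `t ∈ T`, and `(s δ_1, 1)`, `s ∈ S`, where `S` and `T` are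
generating sets of `G` and `H`. -/
def canonicalGenerators (S : Set G) (T : Set H) : Set (WreathProduct G H) :=
  move '' T ∪ single 1 '' S

theorem closure_canonicalGenerators {S : Set G} {T : Set H}
    (hS : Subgroup.closure S = ⊤) (hT : Subgroup.closure T = ⊤) :
    Subgroup.closure (canonicalGenerators S T) = ⊤ := by
  set K := Subgroup.closure (canonicalGenerators S T) with hK
  have hmove : ∀ t : H, move t ∈ K := by
    intro t
    have ht : t ∈ Subgroup.closure T := hT ▸ Subgroup.mem_top t
    induction ht using Subgroup.closure_induction with
    | mem x hx => exact Subgroup.subset_closure (Or.inl ⟨x, hx, rfl⟩)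
    | one => exact K.one_mem
    | mul x y _ _ hx hy =>
      have : (move (x * y) : WreathProduct G H) = move x * move y := by
        ext z <;> simp [move]
      rw [this]; exact K.mul_mem hx hy
    | inv x _ hx =>
      have : (move x⁻¹ : WreathProduct G H) = (move x)⁻¹ := by
        ext z <;> simp [move]
      rw [this]; exact K.inv_mem hx
  have hsingle1 : ∀ s : G, single (1 : H) s ∈ K := by
    intro s
    have hs : s ∈ Subgroup.closure S := hS ▸ Subgroup.mem_top s
    induction hs using Subgroup.closure_induction with
    | mem x hx => exact Subgroup.subset_closure (Or.inr ⟨x, hx, rfl⟩)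
    | one =>
      have : (single (1 : H) (1 : G)) = 1 := by
        ext z <;> simp [single]
      rw [this]; exact K.one_mem
    | mul x y _ _ hx hy =>
      have : single (1 : H) (x * y) = single 1 x * single 1 y := by
        ext z <;> simp [single, Pi.mulSingle_mul]
      rw [this]; exact K.mul_mem hx hy
    | inv x _ hx =>
      have : single (1 : H) x⁻¹ = (single 1 x)⁻¹ := by
        ext z <;> simp [single, Pi.mulSingle_inv]
      rw [this]; exact K.inv_mem hx
  have hsingle : ∀ (x : H) (s : G), single x s ∈ K := by
    intro x s
    have : single x s = move x * single 1 s * (move x)⁻¹ := by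
      ext z
      · by_cases h : z = x
        · subst h; simp [single, move]
        · have h' : x⁻¹ * z ≠ 1 := fun h1 => h (inv_mul_eq_one.1 h1).symm
          simp [single, move, h, h']
      · simp [single, move]
    rw [this]
    exact K.mul_mem (K.mul_mem (hmove x) (hsingle1 s)) (K.inv_mem (hmove x))
  have hlamp : ∀ (F : Finset H) (a : WreathProduct G H),
      Function.mulSupport a.lamp ⊆ F → a ∈ K := by
    intro F
    induction F using Finset.induction_on with
    | empty =>
      intro a ha
      have : a = move a.pos := by
        ext z
        · by_contra hz
          exact absurd (ha (Function.mem_mulSupport.2 hz)) (by simp)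
        · rfl
      rw [this]; exact hmove _
    | insert x F hx ih =>
      intro a ha
      have hb : (single x (a.lamp x))⁻¹ * a ∈ K := by
        apply ih
        intro z hz
        by_cases h : z = x
        · subst h; exact absurd hz (by simp [single])
        · have hz' : a.lamp z ≠ 1 := by simpa [single, h] using hz
          have := ha (Function.mem_mulSupport.2 hz')
          simpa [h] using this
      simpa using K.mul_mem (hsingle x (a.lamp x)) hb
  refine (Subgroup.eq_top_iff' K).2 fun a => hlamp a.finite_support.toFinset a (by simp)

end WreathProduct

/-- The group `ℤ ≀ ℤ`. -/
abbrev ZwrZ : Type := WreathProduct (Multiplicative ℤ) (Multiplicative ℤ)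

/-- The standard symmetric generating set `{1, -1}` of `ℤ`. -/
def intGenerators : Set (Multiplicative ℤ) := {Multiplicative.ofAdd 1, Multiplicative.ofAdd (-1)}

theorem closure_intGenerators : Subgroup.closure intGenerators = ⊤ := by
  refine (Subgroup.eq_top_iff' _).2 fun a => ?_
  have h1 : Multiplicative.ofAdd (1 : ℤ) ∈ Subgroup.closure intGenerators :=
    Subgroup.subset_closure (Or.inl rfl)
  have : a = Multiplicative.ofAdd (1 : ℤ) ^ (Multiplicative.toAdd a) := by
    rw [← ofAdd_zsmul]; simp
  rw [this]
  exact Subgroup.zpow_mem _ h1 _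

/-- The Cayley graph of `ℤ ≀ ℤ` with respect to its canonical generators: distinct `u`, `v` are
adjacent when `v = u s` or `u = v s` for a generator `s`. -/
def cayleyZwrZ : SimpleGraph ZwrZ :=
  SimpleGraph.mulCayley (WreathProduct.canonicalGenerators intGenerators intGenerators)

theorem cayleyZwrZ_connected : cayleyZwrZ.Connected :=
  mulCayley_connected
    (WreathProduct.closure_canonicalGenerators closure_intGenerators closure_intGenerators)

/-- The left-invariant word metric on `ℤ ≀ ℤ` for the canonical generators, that is, the shortest
path metric of the Cayley graph. -/
noncomputable instance : MetricSpace ZwrZ where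
  dist u v := (cayleyZwrZ.dist u v : ℝ)
  dist_self u := by simp
  dist_comm u v := by simp [SimpleGraph.dist_comm]
  dist_triangle u v w := by
    exact_mod_cast cayleyZwrZ_connected.dist_triangle
  eq_of_dist_eq_zero := by
    intro u v h
    exact cayleyZwrZ_connected.dist_eq_zero_iff.1 (by exact_mod_cast h)

/-- `Z` is a stationary reversible Markov chain on the state space `Fin n` with transition
probabilities `a i j = P (Z (t + 1) = j | Z t = i)`. -/
structure IsStationaryReversibleMarkovChain {Ω : Type*} [MeasurableSpace Ω] (P : Measure Ω)
    {n : ℕ} (a : Matrix (Fin n) (Fin n) ℝ) (Z : ℕ → Ω → Fin n) : Prop where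
  measurable : ∀ t, Measurable (Z t)
  nonneg : ∀ i j, 0 ≤ a i j
  row_sum : ∀ i, ∑ j, a i j = 1
  /-- the Markov property: `P (Z₀ = x₀, …, Zₜ₊₁ = xₜ₊₁) = P (Z₀ = x₀, …, Zₜ = xₜ) a(xₜ, xₜ₊₁)` -/
  markov : ∀ (t : ℕ) (x : ℕ → Fin n),
    P.real {ω | ∀ s ≤ t + 1, Z s ω = x s} =
      P.real {ω | ∀ s ≤ t, Z s ω = x s} * a (x t) (x (t + 1))
  stationary : ∀ (t : ℕ) (i : Fin n), P.real {ω | Z t ω = i} = P.real {ω | Z 0 ω = i}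
  reversible : ∀ i j : Fin n,
    P.real {ω | Z 0 ω = i} * a i j = P.real {ω | Z 0 ω = j} * a j i

/-- `X` has `D`-bounded increment Markov type `p` with constant `K`: the Markov type `p` inequality
with constant `K` holds for all chains and maps with `d (f (Z 0)) (f (Z 1)) ≤ D`. -/
def HasBoundedIncrementMarkovTypeWith (X : Type*) [MetricSpace X] (D p K : ℝ) : Prop :=
  ∀ (Ω : Type) [MeasurableSpace Ω] (P : Measure Ω) [IsProbabilityMeasure P]
    (n : ℕ) (a : Matrix (Fin n) (Fin n) ℝ) (Z : ℕ → Ω → Fin n) (f : Fin n → X),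
    IsStationaryReversibleMarkovChain P a Z →
    (∀ᵐ ω ∂P, dist (f (Z 0 ω)) (f (Z 1 ω)) ≤ D) →
    ∀ t : ℕ, ∫ ω, dist (f (Z t ω)) (f (Z 0 ω)) ^ p ∂P ≤
      K ^ p * t * ∫ ω, dist (f (Z 1 ω)) (f (Z 0 ω)) ^ p ∂P

/-- The graph `G`, with its shortest path metric, has edge Markov type `p`: for some constant `K`
the Markov type `p` inequality holds for all chains and maps such that `f (Z 0)`, `f (Z 1)` are
joined by an edge. -/
def HasEdgeMarkovType {V : Type*} (G : SimpleGraph V) (p : ℝ) : Prop :=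
  ∃ K : ℝ, 0 < K ∧
  ∀ (Ω : Type) [MeasurableSpace Ω] (P : Measure Ω) [IsProbabilityMeasure P]
    (n : ℕ) (a : Matrix (Fin n) (Fin n) ℝ) (Z : ℕ → Ω → Fin n) (f : Fin n → V),
    IsStationaryReversibleMarkovChain P a Z →
    (∀ᵐ ω ∂P, G.Adj (f (Z 0 ω)) (f (Z 1 ω))) →
    ∀ t : ℕ, ∫ ω, (G.dist (f (Z t ω)) (f (Z 0 ω)) : ℝ) ^ p ∂P ≤
      K ^ p * t * ∫ ω, (G.dist (f (Z 1 ω)) (f (Z 0 ω)) : ℝ) ^ p ∂P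

/-- `X` has Enflo type `p`. The cube `{-1, 1}ⁿ` is `Fin n → ℤˣ`, and `𝔼` is the average with respect
to the uniform measure on it. -/
def HasEnfloType (X : Type*) [MetricSpace X] (p : ℝ) : Prop :=
  ∃ K : ℝ, 0 < K ∧ ∀ (n : ℕ) (f : (Fin n → ℤˣ) → X),
    (𝔼 ε : Fin n → ℤˣ, dist (f ε) (f (-ε)) ^ p) ≤
      K ^ p * ∑ j : Fin n, 𝔼 ε : Fin n → ℤˣ,
        dist (f ε) (f (Function.update ε j (-ε j))) ^ p

/-! The positive results come from a Lipschitz map of the group into a Hilbert space with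
compression exponent at least α, for each α < 2/3. Hilbert space has Markov type 2 with constant 1,
and this follows coordinate by coordinate from the real line (`sum_pow_mul_sub_sq_le`). So 𝔼 d(Z_t,
Z_0)^(2α) is at most a constant times 𝔼‖F(Z_t) - F(Z_0)‖² ≤ t 𝔼‖F(Z_1) - F(Z_0)‖², hence at most a
constant times t 𝔼 d(Z_1, Z_0)². Increments bounded by D turn the last square into D^(2-2α) d^(2α).
The edge statement is the case D = 1. Since the state space is finite, finitely many coordinates
suffice, and the infinite-dimensional target never has to be built.

The coordinates of the map are the position, the lamps, and the functions `halfLineCoord`. The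
latter record the lamps on a half-line ahead of the walker, weighted by the β-th power of the
walker's distance to it. Changing the lamp at the walker does not affect them, and moving changes
the weights by a square-summable amount when β < 1/2. If the lamps differ at distance M from the
walker, about M half-lines see the difference and contribute order M^(1+2β) = M^(3α) to the squared
distance. On the other hand d is at most the ℓ¹ distance of the lamps plus O(M), and Cauchy–Schwarz
on an interval of length O(M) compares ℓ¹ with ℓ². Balancing the two at M ~ d^(2/3) gives the
compression bound (`rpow_le_of_radius_bounds`).

Enflo type p > 1 fails on cubes of n lamps with values ±n. Walking past all the lamps costs no more
than a constant times flipping one of them, so edges have length O(n), while antipodes are at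
distance at least 2n². -/

/-! ### Integer coordinates and Cayley graph steps -/

/-- The position in `ℤ` of an element of `ℤ ≀ ℤ`. -/
def posInt (u : ZwrZ) : ℤ := Multiplicative.toAdd u.pos

/-- The lamp configuration `ℤ → ℤ` of an element of `ℤ ≀ ℤ`. -/
def lampInt (u : ZwrZ) (z : ℤ) : ℤ := Multiplicative.toAdd (u.lamp (Multiplicative.ofAdd z))

theorem ZwrZ.ext_int {u v : ZwrZ} (hp : posInt u = posInt v)
    (hl : ∀ z, lampInt u z = lampInt v z) : u = v := by
  ext z
  · exact Multiplicative.toAdd.injective (hl (Multiplicative.toAdd z))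
  · exact Multiplicative.toAdd.injective hp

theorem finite_lampInt_ne (u v : ZwrZ) : {z | lampInt u z ≠ lampInt v z}.Finite := by
  refine ((u.finite_support.union v.finite_support).preimage
    (Multiplicative.ofAdd.injective.injOn (s := Set.univ) |>.mono (Set.subset_univ _))).subset ?_
  intro z hz
  by_contra h
  simp only [Set.mem_preimage, Set.mem_union, Function.mem_mulSupport, not_or, not_not] at h
  exact hz (by simp [lampInt, h.1, h.2])

theorem posInt_mul (u v : ZwrZ) : posInt (u * v) = posInt u + posInt v := rfl

theorem lampInt_mul (u v : ZwrZ) (z : ℤ) :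
    lampInt (u * v) z = lampInt u z + lampInt v (z - posInt u) := by
  have : (u.pos)⁻¹ * Multiplicative.ofAdd z = Multiplicative.ofAdd (z - posInt u) := by
    rw [sub_eq_neg_add]; rfl
  simp only [lampInt, WreathProduct.mul_lamp, this, toAdd_mul]

/-- The relation "`v` is `u` times the generator `(0, s)` or `(s δ₀, 0)`", in coordinates. -/
def IsStep (s : ℤ) (u v : ZwrZ) : Prop :=
  (posInt v = posInt u + s ∧ ∀ z, lampInt v z = lampInt u z) ∨
  (posInt v = posInt u ∧ ∀ z, lampInt v z = lampInt u z + if z = posInt u then s else 0)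

theorem IsStep.symm {s : ℤ} {u v : ZwrZ} (h : IsStep s u v) : IsStep (-s) v u := by
  rcases h with ⟨h1, h2⟩ | ⟨h1, h2⟩
  · exact Or.inl ⟨by rw [h1]; ring, fun z => (h2 z).symm⟩
  · refine Or.inr ⟨h1.symm, fun z => ?_⟩
    rw [h2, h1]; split_ifs <;> ring

theorem isStep_mul_move (u : ZwrZ) (s : ℤ) :
    posInt (u * WreathProduct.move (Multiplicative.ofAdd s)) = posInt u + s ∧
      ∀ z, lampInt (u * WreathProduct.move (Multiplicative.ofAdd s)) z = lampInt u z := by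
  refine ⟨posInt_mul _ _, fun z => ?_⟩
  rw [lampInt_mul]; simp [lampInt, WreathProduct.move]

theorem isStep_mul_single (u : ZwrZ) (s : ℤ) :
    posInt (u * WreathProduct.single 1 (Multiplicative.ofAdd s)) = posInt u ∧
      ∀ z, lampInt (u * WreathProduct.single 1 (Multiplicative.ofAdd s)) z =
        lampInt u z + if z = posInt u then s else 0 := by
  refine ⟨by rw [posInt_mul]; simp [posInt, WreathProduct.single], fun z => ?_⟩
  rw [lampInt_mul]
  congr 1
  by_cases h : z = posInt u
  · subst h; simp [lampInt, WreathProduct.single]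
  · have : Multiplicative.ofAdd (z - posInt u) ≠ 1 := by
      intro h'
      exact h (sub_eq_zero.1 (Multiplicative.ofAdd.injective h'))
    rw [if_neg h]
    exact congrArg Multiplicative.toAdd (Pi.mulSingle_eq_of_ne this _)

theorem isStep_mul_of_mem {s : ZwrZ}
    (hs : s ∈ WreathProduct.canonicalGenerators intGenerators intGenerators) (u : ZwrZ) :
    ∃ k : ℤ, (k = 1 ∨ k = -1) ∧ IsStep k u (u * s) := by
  rcases hs with ⟨t, ht, rfl⟩ | ⟨t, ht, rfl⟩
  · rcases ht with rfl | rfl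
    · exact ⟨1, Or.inl rfl, Or.inl (isStep_mul_move u 1)⟩
    · exact ⟨-1, Or.inr rfl, Or.inl (isStep_mul_move u (-1))⟩
  · rcases ht with rfl | rfl
    · exact ⟨1, Or.inl rfl, Or.inr (isStep_mul_single u 1)⟩
    · exact ⟨-1, Or.inr rfl, Or.inr (isStep_mul_single u (-1))⟩

theorem exists_isStep_of_adj {u v : ZwrZ} (h : cayleyZwrZ.Adj u v) :
    ∃ k : ℤ, (k = 1 ∨ k = -1) ∧ IsStep k u v := by
  obtain ⟨-, s, hs, h⟩ := (SimpleGraph.mulCayley_adj' _ u v).1 h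
  rcases h with rfl | rfl
  · exact isStep_mul_of_mem hs u
  · obtain ⟨k, hk, hk'⟩ := isStep_mul_of_mem hs v
    exact ⟨-k, by omega, hk'.symm⟩

/-! ### Upper bounds for the word metric -/

theorem dist_mul_generator_le {s : ZwrZ}
    (hs : s ∈ WreathProduct.canonicalGenerators intGenerators intGenerators) (u : ZwrZ) :
    dist u (u * s) ≤ 1 := by
  by_cases h : u = u * s
  · rw [← h]; simp
  · have : cayleyZwrZ.Adj u (u * s) :=
      (SimpleGraph.mulCayley_adj' _ u (u * s)).2 ⟨h, s, hs, Or.inl rfl⟩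
    change ((cayleyZwrZ.dist u (u * s) : ℕ) : ℝ) ≤ 1
    rw [SimpleGraph.dist_eq_one_iff_adj.2 this]; simp

theorem dist_mul_move_le (u : ZwrZ) {k : ℤ} (hk : k = 1 ∨ k = -1) :
    dist u (u * WreathProduct.move (Multiplicative.ofAdd k)) ≤ 1 := by
  refine dist_mul_generator_le (Or.inl ⟨_, ?_, rfl⟩) u
  rcases hk with rfl | rfl
  · exact Or.inl rfl
  · exact Or.inr rfl

theorem dist_mul_single_le (u : ZwrZ) {k : ℤ} (hk : k = 1 ∨ k = -1) :
    dist u (u * WreathProduct.single 1 (Multiplicative.ofAdd k)) ≤ 1 := by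
  refine dist_mul_generator_le (Or.inr ⟨_, ?_, rfl⟩) u
  rcases hk with rfl | rfl
  · exact Or.inl rfl
  · exact Or.inr rfl

theorem exists_dist_move_le (u : ZwrZ) {s : ℤ} (hs : s = 1 ∨ s = -1) (n : ℕ) :
    ∃ v, posInt v = posInt u + s * n ∧ (∀ z, lampInt v z = lampInt u z) ∧ dist u v ≤ n := by
  induction n with
  | zero => exact ⟨u, by simp, fun _ => rfl, by simp⟩
  | succ n ih =>
    obtain ⟨v, h1, h2, h3⟩ := ih
    obtain ⟨h4, h5⟩ := isStep_mul_move v s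
    refine ⟨_, by rw [h4, h1]; push_cast; ring, fun z => by rw [h5, h2], ?_⟩
    have := dist_triangle u v (v * WreathProduct.move (Multiplicative.ofAdd s))
    have := dist_mul_move_le v hs
    push_cast; linarith

theorem exists_dist_single_le (u : ZwrZ) {s : ℤ} (hs : s = 1 ∨ s = -1) (n : ℕ) :
    ∃ v, posInt v = posInt u ∧
      (∀ z, lampInt v z = lampInt u z + if z = posInt u then s * n else 0) ∧ dist u v ≤ n := by
  induction n with
  | zero => exact ⟨u, by simp, by simp, by simp⟩
  | succ n ih =>
    obtain ⟨v, h1, h2, h3⟩ := ih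
    obtain ⟨h4, h5⟩ := isStep_mul_single v s
    refine ⟨_, h4.trans h1, fun z => ?_, ?_⟩
    · rw [h5, h2, h1]; split_ifs
      · push_cast; ring
      · ring
    have := dist_triangle u v (v * WreathProduct.single 1 (Multiplicative.ofAdd s))
    have := dist_mul_single_le v hs
    push_cast; linarith

theorem Int.exists_sign_mul_natAbs (k : ℤ) :
    ∃ s : ℤ, (s = 1 ∨ s = -1) ∧ k = s * k.natAbs := by
  rcases k.natAbs_eq with h | h
  · exact ⟨1, Or.inl rfl, by omega⟩
  · exact ⟨-1, Or.inr rfl, by omega⟩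

theorem exists_move (u : ZwrZ) (k : ℤ) :
    ∃ v, posInt v = posInt u + k ∧ (∀ z, lampInt v z = lampInt u z) ∧ dist u v ≤ |(k : ℝ)| := by
  obtain ⟨s, hs, hk⟩ := Int.exists_sign_mul_natAbs k
  obtain ⟨v, h1, h2, h3⟩ := exists_dist_move_le u hs k.natAbs
  exact ⟨v, by rw [h1, ← hk], h2, by rwa [Nat.cast_natAbs, Int.cast_abs] at h3⟩

theorem exists_single (u : ZwrZ) (k : ℤ) :
    ∃ v, posInt v = posInt u ∧
      (∀ z, lampInt v z = lampInt u z + if z = posInt u then k else 0) ∧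
      dist u v ≤ |(k : ℝ)| := by
  obtain ⟨s, hs, hk⟩ := Int.exists_sign_mul_natAbs k
  obtain ⟨v, h1, h2, h3⟩ := exists_dist_single_le u hs k.natAbs
  exact ⟨v, h1, by rwa [← hk] at h2, by rwa [Nat.cast_natAbs, Int.cast_abs] at h3⟩

/-- Sweeping the interval of length `k` to the right of the current position. -/
theorem exists_sweep (u : ZwrZ) (δ : ℤ → ℤ) (k : ℕ) :
    ∃ v, posInt v = posInt u + k ∧
      (∀ z, lampInt v z =
        lampInt u z + if posInt u ≤ z ∧ z < posInt u + k then δ z else 0) ∧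
      dist u v ≤ k + ∑ j ∈ Finset.range k, |(δ (posInt u + j) : ℝ)| := by
  induction k with
  | zero =>
    refine ⟨u, by simp, fun z => ?_, by simp⟩
    rw [if_neg (by push_cast; omega), add_zero]
  | succ k ih =>
    obtain ⟨v, h1, h2, h3⟩ := ih
    obtain ⟨w, h4, h5, h6⟩ := exists_single v (δ (posInt u + k))
    obtain ⟨w', h7, h8, h9⟩ := exists_move w 1
    refine ⟨w', by rw [h7, h4, h1]; push_cast; ring, fun z => ?_, ?_⟩
    · rw [h8, h5, h2, h1]
      by_cases hz : z = posInt u + k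
      · subst hz
        rw [if_neg (by omega), if_pos rfl, if_pos (by push_cast; omega)]; ring
      · rw [if_neg hz, add_zero]
        congr 1
        refine if_congr ?_ rfl rfl
        push_cast; omega
    · rw [Finset.sum_range_succ]
      have := dist_triangle u v w
      have := dist_triangle u w w'
      simp only [Int.cast_one, abs_one] at h9
      push_cast; linarith

/-- An explicit path: walk to the left end of an interval containing all differing lamps, correct
them in one pass to the right, then walk to the final position. -/
theorem dist_le_sweep (u v : ZwrZ) (a : ℤ) (N : ℕ)
    (h : ∀ z, ¬ (a ≤ z ∧ z < a + N) → lampInt u z = lampInt v z) :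
    dist u v ≤ |((a - posInt u : ℤ) : ℝ)| +
      (N + ∑ j ∈ Finset.range N, |((lampInt v (a + j) - lampInt u (a + j) : ℤ) : ℝ)|) +
      |((posInt v - (a + N) : ℤ) : ℝ)| := by
  obtain ⟨u₁, h1, h2, h3⟩ := exists_move u (a - posInt u)
  obtain ⟨u₂, h4, h5, h6⟩ := exists_sweep u₁ (fun z => lampInt v z - lampInt u z) N
  obtain ⟨u₃, h7, h8, h9⟩ := exists_move u₂ (posInt v - (a + N))
  have ha : posInt u₁ = a := by rw [h1]; ring
  rw [ha] at h4 h5 h6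
  have : u₃ = v := by
    refine ZwrZ.ext_int (by rw [h7, h4]; ring) fun z => ?_
    rw [h8, h5, h2]
    split_ifs with hz
    · ring
    · rw [add_zero, h z hz]
  subst this
  have := dist_triangle u u₁ u₂
  have := dist_triangle u u₂ u₃
  linarith

/-! ### Lipschitz bounds checked on single steps -/

theorem dist_le_mul_of_adj {E : Type*} [PseudoMetricSpace E] (F : ZwrZ → E) (L : ℝ)
    (h : ∀ u v, cayleyZwrZ.Adj u v → dist (F u) (F v) ≤ L) (u v : ZwrZ) :
    dist (F u) (F v) ≤ L * dist u v := by
  obtain ⟨p, hp⟩ := cayleyZwrZ_connected.exists_walk_length_eq_dist u v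
  change _ ≤ L * (cayleyZwrZ.dist u v : ℝ)
  rw [← hp]
  clear hp
  induction p with
  | nil => simp
  | cons hadj p ih =>
    refine (dist_triangle _ _ _).trans ((add_le_add (h _ _ hadj) ih).trans_eq ?_)
    rw [SimpleGraph.Walk.length_cons]; push_cast; ring

theorem dist_le_mul_of_isStep {E : Type*} [PseudoMetricSpace E] (F : ZwrZ → E) (L : ℝ)
    (h : ∀ u v k, (k = 1 ∨ k = -1) → IsStep k u v → dist (F u) (F v) ≤ L) (u v : ZwrZ) :
    dist (F u) (F v) ≤ L * dist u v := by
  refine dist_le_mul_of_adj F L (fun u v huv => ?_) u v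
  obtain ⟨k, hk, hs⟩ := exists_isStep_of_adj huv
  exact h u v k hk hs

/-- One step changes at most one lamp, and by one, so the ℓ¹ distance to the fixed configuration of
`v` is a 1-Lipschitz function. -/
theorem sum_abs_lampInt_sub_le (S : Finset ℤ) (u v : ZwrZ) :
    ∑ z ∈ S, |((lampInt u z - lampInt v z : ℤ) : ℝ)| ≤ dist u v := by
  have key := dist_le_mul_of_isStep
    (fun w => ∑ z ∈ S, |((lampInt w z - lampInt v z : ℤ) : ℝ)|) 1 ?_ u v
  · simp only [Real.dist_eq, sub_self, Int.cast_zero, abs_zero, Finset.sum_const_zero, sub_zero,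
      one_mul] at key
    exact (le_abs_self _).trans key
  · intro w w' k hk hs
    rw [Real.dist_eq, ← Finset.sum_sub_distrib]
    refine (Finset.abs_sum_le_sum_abs _ _).trans ?_
    have hterm : ∀ z ∈ S, |(|((lampInt w z - lampInt v z : ℤ) : ℝ)| -
        |((lampInt w' z - lampInt v z : ℤ) : ℝ)|)| ≤ if z = posInt w then (1 : ℝ) else 0 := by
      intro z _
      refine (abs_abs_sub_abs_le_abs_sub _ _).trans ?_
      rcases hs with ⟨-, h2⟩ | ⟨-, h2⟩
      · rw [h2]; simp; split_ifs <;> norm_num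
      · rw [h2]
        split_ifs
        · rcases hk with rfl | rfl <;> · push_cast; ring_nf; simp
        · simp
    refine (Finset.sum_le_sum hterm).trans ?_
    rw [Finset.sum_ite_eq']
    split_ifs <;> norm_num

/-! ### Markov type 2 of the real line -/

section ReversibleMatrix

variable {ι : Type*} [Fintype ι] {w : ι → ℝ} {a : Matrix ι ι ℝ}

open Matrix

/-- The inner product weighted by `w`. -/
def weightedInner (w f g : ι → ℝ) : ℝ := ∑ i, w i * (f i * g i)

theorem weightedInner_comm (f g : ι → ℝ) : weightedInner w f g = weightedInner w g f := by
  simp only [weightedInner, mul_comm (f _)]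

theorem weightedInner_sub_left (f g h : ι → ℝ) :
    weightedInner w (f - g) h = weightedInner w f h - weightedInner w g h := by
  simp only [weightedInner, Pi.sub_apply, ← Finset.sum_sub_distrib]
  exact Finset.sum_congr rfl fun i _ => by ring

theorem weightedInner_self_nonneg (hw : ∀ i, 0 ≤ w i) (f : ι → ℝ) : 0 ≤ weightedInner w f f :=
  Finset.sum_nonneg fun i _ => mul_nonneg (hw i) (mul_self_nonneg _)

theorem weightedInner_mulVec (f g : ι → ℝ) :
    weightedInner w (a *ᵥ f) g = ∑ i, ∑ j, w i * a i j * (f j * g i) := by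
  simp only [weightedInner, mulVec, dotProduct, Finset.sum_mul, Finset.mul_sum]
  exact Finset.sum_congr rfl fun i _ => Finset.sum_congr rfl fun j _ => by ring

theorem weightedInner_mulVec_comm (hrev : ∀ i j, w i * a i j = w j * a j i) (f g : ι → ℝ) :
    weightedInner w (a *ᵥ f) g = weightedInner w f (a *ᵥ g) := by
  rw [weightedInner_comm f, weightedInner_mulVec, weightedInner_mulVec, Finset.sum_comm]
  refine Finset.sum_congr rfl fun i _ => Finset.sum_congr rfl fun j _ => ?_
  rw [hrev]; ring

theorem sum_mul_sq_left (hrow : ∀ i, ∑ j, a i j = 1) (f : ι → ℝ) :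
    ∑ i, ∑ j, w i * a i j * (f i * f i) = weightedInner w f f := by
  refine Finset.sum_congr rfl fun i _ => ?_
  rw [← Finset.sum_mul, ← Finset.mul_sum, hrow, mul_one]

theorem sum_mul_sq_right (hrow : ∀ i, ∑ j, a i j = 1) (hrev : ∀ i j, w i * a i j = w j * a j i)
    (f : ι → ℝ) : ∑ i, ∑ j, w i * a i j * (f j * f j) = weightedInner w f f := by
  rw [Finset.sum_comm, ← sum_mul_sq_left hrow]
  refine Finset.sum_congr rfl fun i _ => Finset.sum_congr rfl fun j _ => ?_
  rw [hrev]

theorem sum_mul_sub_sq (hrow : ∀ i, ∑ j, a i j = 1) (hrev : ∀ i j, w i * a i j = w j * a j i)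
    (f : ι → ℝ) : ∑ i, ∑ j, w i * a i j * (f i - f j) ^ 2 =
      2 * (weightedInner w f f - weightedInner w (a *ᵥ f) f) := by
  have h : ∑ i, ∑ j, w i * a i j * (f i - f j) ^ 2 = ∑ i, ∑ j, w i * a i j * (f i * f i) +
      ∑ i, ∑ j, w i * a i j * (f j * f j) - 2 * ∑ i, ∑ j, w i * a i j * (f j * f i) := by
    simp only [Finset.mul_sum, ← Finset.sum_add_distrib, ← Finset.sum_sub_distrib]
    exact Finset.sum_congr rfl fun i _ => Finset.sum_congr rfl fun j _ => by ring
  rw [h, sum_mul_sq_left hrow, sum_mul_sq_right hrow hrev, weightedInner_mulVec]; ring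

theorem weightedInner_self_add_mulVec_nonneg (hw : ∀ i, 0 ≤ w i) (ha : ∀ i j, 0 ≤ a i j)
    (hrow : ∀ i, ∑ j, a i j = 1) (hrev : ∀ i j, w i * a i j = w j * a j i) (f : ι → ℝ) :
    0 ≤ weightedInner w f f + weightedInner w (a *ᵥ f) f := by
  have h : ∑ i, ∑ j, w i * a i j * (f i + f j) ^ 2 = ∑ i, ∑ j, w i * a i j * (f i * f i) +
      ∑ i, ∑ j, w i * a i j * (f j * f j) + 2 * ∑ i, ∑ j, w i * a i j * (f j * f i) := by
    simp only [Finset.mul_sum, ← Finset.sum_add_distrib]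
    exact Finset.sum_congr rfl fun i _ => Finset.sum_congr rfl fun j _ => by ring
  rw [sum_mul_sq_left hrow, sum_mul_sq_right hrow hrev, ← weightedInner_mulVec] at h
  have : 0 ≤ ∑ i, ∑ j, w i * a i j * (f i + f j) ^ 2 :=
    Finset.sum_nonneg fun i _ => Finset.sum_nonneg fun j _ =>
      mul_nonneg (mul_nonneg (hw i) (ha i j)) (sq_nonneg _)
  linarith

variable [DecidableEq ι]

theorem weightedInner_pow_comm (hrev : ∀ i j, w i * a i j = w j * a j i) (k : ℕ) (f g : ι → ℝ) :
    weightedInner w ((a ^ k) *ᵥ f) g = weightedInner w f ((a ^ k) *ᵥ g) := by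
  induction k generalizing f g with
  | zero => simp
  | succ k ih =>
    rw [pow_succ, ← mulVec_mulVec, ih, weightedInner_mulVec_comm hrev, mulVec_mulVec, ← pow_succ',
      ← pow_succ]

theorem weightedInner_pow_add (hrev : ∀ i j, w i * a i j = w j * a j i) (k l : ℕ)
    (f g : ι → ℝ) : weightedInner w ((a ^ (k + l)) *ᵥ f) g =
      weightedInner w ((a ^ l) *ᵥ f) ((a ^ k) *ᵥ g) := by
  rw [pow_add, ← mulVec_mulVec, weightedInner_pow_comm hrev]

/-- Spectrally this is λ^s (1 - λ) ≤ 1 - λ for λ ∈ [-1, 1]. The proof avoids diagonalisation: the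
second differences of q s = ⟨a^s f, f⟩ are the numbers ⟨a^s g, g⟩ with g = f - a f. Positivity of
these at even s, and of the sum of two consecutive ones starting at even s, controls the first
differences. -/
theorem weightedInner_pow_sub_le (hw : ∀ i, 0 ≤ w i) (ha : ∀ i j, 0 ≤ a i j)
    (hrow : ∀ i, ∑ j, a i j = 1) (hrev : ∀ i j, w i * a i j = w j * a j i) (f : ι → ℝ) (s : ℕ) :
    weightedInner w ((a ^ s) *ᵥ f) f - weightedInner w ((a ^ (s + 1)) *ᵥ f) f ≤
      weightedInner w f f - weightedInner w (a *ᵥ f) f := by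
  set q : ℕ → ℝ := fun s => weightedInner w ((a ^ s) *ᵥ f) f with hq
  set g := f - a *ᵥ f with hg
  have hsecond : ∀ s, weightedInner w ((a ^ s) *ᵥ g) g = q s - 2 * q (s + 1) + q (s + 2) := by
    intro s
    have h1 : weightedInner w ((a ^ s) *ᵥ g) (a *ᵥ f) =
        weightedInner w ((a ^ (s + 1)) *ᵥ g) f := by
      rw [pow_succ', ← mulVec_mulVec, weightedInner_mulVec_comm hrev]
    have h2 : ∀ s, weightedInner w ((a ^ s) *ᵥ g) f = q s - q (s + 1) := by
      intro s
      rw [hg, mulVec_sub, weightedInner_sub_left, mulVec_mulVec, ← pow_succ]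
    rw [weightedInner_comm, hg, weightedInner_sub_left, ← hg, weightedInner_comm f,
      weightedInner_comm (a *ᵥ f), h1, h2, h2]
    ring
  have heven : ∀ k, 0 ≤ weightedInner w ((a ^ (2 * k)) *ᵥ g) g := by
    intro k
    rw [two_mul, weightedInner_pow_add hrev]
    exact weightedInner_self_nonneg hw _
  -- With h = a^k g this is ⟨h, h⟩ + ⟨a h, h⟩ ≥ 0. It says that the first differences of q at even
  -- times do not increase.
  have heven' : ∀ k, 0 ≤ weightedInner w ((a ^ (2 * k)) *ᵥ g) g +
      weightedInner w ((a ^ (2 * k + 1)) *ᵥ g) g := by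
    intro k
    have := weightedInner_self_add_mulVec_nonneg hw ha hrow hrev ((a ^ k) *ᵥ g)
    rw [mulVec_mulVec, ← pow_succ'] at this
    rw [show 2 * k + 1 = k + (k + 1) by ring, weightedInner_pow_add hrev, two_mul,
      weightedInner_pow_add hrev]
    exact this
  have hmain : ∀ k, q (2 * k) - q (2 * k + 1) ≤ q 0 - q 1 := by
    intro k
    induction k with
    | zero => exact le_rfl
    | succ k ih =>
      have := heven' k
      rw [hsecond, hsecond] at this
      rw [show 2 * (k + 1) = 2 * k + 2 by ring]
      have e : 2 * k + 1 + 2 = 2 * k + 2 + 1 := by ring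
      have e' : 2 * k + 1 + 1 = 2 * k + 2 := by ring
      rw [e, e'] at this
      linarith
  have h0 : weightedInner w f f = q 0 := by simp [hq]
  have h1 : weightedInner w (a *ᵥ f) f = q 1 := by simp [hq]
  rw [h0, h1]
  change q s - q (s + 1) ≤ _
  obtain ⟨k, rfl | rfl⟩ := s.even_or_odd'
  · exact hmain k
  -- A first difference at an odd time is at most the one just before it, by convexity of q at the
  -- even time.
  · have := heven k
    rw [hsecond] at this
    have := hmain k
    linarith

theorem row_sum_pow (hrow : ∀ i, ∑ j, a i j = 1) (t : ℕ) (i : ι) : ∑ j, (a ^ t) i j = 1 := by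
  induction t generalizing i with
  | zero => simp [Matrix.one_apply]
  | succ t ih =>
    simp only [pow_succ', Matrix.mul_apply]
    rw [Finset.sum_comm]
    simp only [← Finset.mul_sum, ih, mul_one, hrow]

theorem pow_apply_nonneg (ha : ∀ i j, 0 ≤ a i j) (t : ℕ) (i j : ι) : 0 ≤ (a ^ t) i j := by
  induction t generalizing i with
  | zero => rw [pow_zero, Matrix.one_apply]; split_ifs <;> norm_num
  | succ t ih =>
    rw [pow_succ', Matrix.mul_apply]
    exact Finset.sum_nonneg fun l _ => mul_nonneg (ha _ _) (ih _)

theorem reversible_pow (hrev : ∀ i j, w i * a i j = w j * a j i) (t : ℕ) (i j : ι) :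
    w i * (a ^ t) i j = w j * (a ^ t) j i := by
  induction t generalizing i j with
  | zero =>
    rw [pow_zero, Matrix.one_apply, Matrix.one_apply]
    by_cases h : i = j
    · rw [h]
    · rw [if_neg h, if_neg (Ne.symm h)]; simp
  | succ t ih =>
    have h1 : (a ^ (t + 1)) i j = ∑ l, a i l * (a ^ t) l j := by rw [pow_succ', Matrix.mul_apply]
    have h2 : (a ^ (t + 1)) j i = ∑ l, (a ^ t) j l * a l i := by rw [pow_succ, Matrix.mul_apply]
    rw [h1, h2, Finset.mul_sum, Finset.mul_sum]
    refine Finset.sum_congr rfl fun l _ => ?_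
    rw [← mul_assoc, hrev, ← mul_assoc, ← ih, mul_right_comm]

/-- The real line has Markov type 2 with constant 1. -/
theorem sum_pow_mul_sub_sq_le (hw : ∀ i, 0 ≤ w i) (ha : ∀ i j, 0 ≤ a i j)
    (hrow : ∀ i, ∑ j, a i j = 1) (hrev : ∀ i j, w i * a i j = w j * a j i) (f : ι → ℝ) (t : ℕ) :
    ∑ i, ∑ j, w i * (a ^ t) i j * (f i - f j) ^ 2 ≤
      t * ∑ i, ∑ j, w i * a i j * (f i - f j) ^ 2 := by
  rw [sum_mul_sub_sq (row_sum_pow hrow t) (reversible_pow hrev t), sum_mul_sub_sq hrow hrev]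
  suffices h : weightedInner w f f - weightedInner w ((a ^ t) *ᵥ f) f ≤
      t * (weightedInner w f f - weightedInner w (a *ᵥ f) f) by linarith
  induction t with
  | zero => simp
  | succ t ih =>
    have := weightedInner_pow_sub_le hw ha hrow hrev f t
    push_cast; linarith

end ReversibleMatrix

/-! ### From the probability space to weighted sums -/

namespace IsStationaryReversibleMarkovChain

variable {Ω : Type*} [MeasurableSpace Ω] {P : Measure Ω} [IsProbabilityMeasure P] {n : ℕ}
  {a : Matrix (Fin n) (Fin n) ℝ} {Z : ℕ → Ω → Fin n}

/-- The Markov property is given for whole initial paths only, so the induction on the lag `m` keeps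
the past up to `t` and extends it by each possible next state. -/
theorem measureReal_inter_future (h : IsStationaryReversibleMarkovChain P a Z) (m : ℕ) :
    ∀ (t : ℕ) (x : ℕ → Fin n) (k : Fin n),
      P.real ({ω | ∀ s ≤ t, Z s ω = x s} ∩ {ω | Z (t + m) ω = k}) =
        P.real {ω | ∀ s ≤ t, Z s ω = x s} * (a ^ m) (x t) k := by
  induction m with
  | zero =>
    intro t x k
    rw [pow_zero, Matrix.one_apply, add_zero]
    split_ifs with hk
    · rw [mul_one]
      congr 1
      ext ω
      simp only [Set.mem_inter_iff, Set.mem_ofPred_eq, and_iff_left_iff_imp]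
      exact fun h => (h t le_rfl).trans hk
    · rw [mul_zero]
      convert measureReal_empty (μ := P)
      ext ω
      simp only [Set.mem_inter_iff, Set.mem_ofPred_eq, Set.mem_empty_iff_false, iff_false, not_and]
      exact fun h h' => hk ((h t le_rfl).symm.trans h')
  | succ m ih =>
    intro t x k
    have hset : ∀ l : Fin n, {ω | ∀ s ≤ t + 1, Z s ω = Function.update x (t + 1) l s} =
        {ω | ∀ s ≤ t, Z s ω = x s} ∩ Z (t + 1) ⁻¹' {l} := by
      intro l
      ext ω
      simp only [Set.mem_ofPred_eq, Set.mem_inter_iff, Set.mem_preimage, Set.mem_singleton_iff]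
      refine ⟨fun h => ⟨fun s hs => ?_, ?_⟩, fun h s hs => ?_⟩
      · rw [h s (by omega), Function.update_of_ne (by omega)]
      · rw [h (t + 1) le_rfl, Function.update_self]
      · rcases Nat.lt_or_eq_of_le hs with h' | rfl
        · rw [Function.update_of_ne (by omega), h.1 s (by omega)]
        · rw [Function.update_self, h.2]
    have hsplit : P.real ({ω | ∀ s ≤ t, Z s ω = x s} ∩ {ω | Z (t + (m + 1)) ω = k}) =
        ∑ l, P.real ({ω | ∀ s ≤ t + 1, Z s ω = Function.update x (t + 1) l s} ∩
          {ω | Z (t + 1 + m) ω = k}) := by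
      rw [← measureReal_biUnion_finset]
      · congr 1
        ext ω
        simp only [hset, Set.mem_iUnion, Finset.mem_univ, exists_true_left, Set.mem_inter_iff,
          Set.mem_ofPred_eq, Set.mem_preimage, Set.mem_singleton_iff,
          show t + (m + 1) = t + 1 + m by ring]
        exact ⟨fun h => ⟨_, ⟨h.1, rfl⟩, h.2⟩, fun ⟨_, h1, h2⟩ => ⟨h1.1, h2⟩⟩
      · intro l _ l' _ hl
        refine Set.disjoint_left.2 fun ω h1 h2 => hl ?_
        simp only [hset] at h1 h2
        exact Eq.trans (Eq.symm h1.1.2) h2.1.2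
      · intro l _
        rw [hset]
        have hle : MeasurableSet {ω | ∀ s ≤ t, Z s ω = x s} := by
          have : {ω | ∀ s ≤ t, Z s ω = x s} = ⋂ s ∈ Set.Iic t, Z s ⁻¹' {x s} := by
            ext ω; simp
          rw [this]
          exact MeasurableSet.biInter (Set.to_countable _)
            fun s _ => h.measurable s (measurableSet_singleton _)
        exact (hle.inter (h.measurable _ (measurableSet_singleton _))).inter
          (h.measurable (t + 1 + m) (measurableSet_singleton k))
    rw [hsplit, pow_succ', Matrix.mul_apply, Finset.mul_sum]
    refine Finset.sum_congr rfl fun l _ => ?_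
    rw [ih, h.markov, Function.update_self, Function.update_of_ne (by omega), ← mul_assoc]
    congr 3
    ext ω
    refine forall₂_congr fun s hs => ?_
    rw [Function.update_of_ne (by omega)]

theorem measureReal_pair (h : IsStationaryReversibleMarkovChain P a Z) (t : ℕ) (i j : Fin n) :
    P.real {ω | Z 0 ω = i ∧ Z t ω = j} = P.real {ω | Z 0 ω = i} * (a ^ t) i j := by
  have := h.measureReal_inter_future t 0 (fun _ => i) j
  simpa [Set.ofPred_and] using this

theorem integral_pair (h : IsStationaryReversibleMarkovChain P a Z) (t : ℕ)
    (G : Fin n → Fin n → ℝ) : ∫ ω, G (Z t ω) (Z 0 ω) ∂P =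
      ∑ i, ∑ j, P.real {ω | Z 0 ω = i} * (a ^ t) i j * G j i := by
  have hm : Measurable fun ω => (Z 0 ω, Z t ω) := (h.measurable 0).prodMk (h.measurable t)
  have h1 : ∫ ω, G (Z t ω) (Z 0 ω) ∂P =
      ∫ x, G x.2 x.1 ∂(P.map fun ω => (Z 0 ω, Z t ω)) := by
    rw [integral_map hm.aemeasurable (measurable_of_finite _).aestronglyMeasurable]
  have := Measure.isProbabilityMeasure_map (μ := P) hm.aemeasurable
  rw [h1, integral_fintype Integrable.of_finite, Fintype.sum_prod_type]
  refine Finset.sum_congr rfl fun i _ => Finset.sum_congr rfl fun j _ => ?_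
  rw [map_measureReal_apply hm (measurableSet_singleton _), ← h.measureReal_pair, smul_eq_mul]
  congr 2
  ext ω; simp

/-- This turns an almost sure condition on the first step into a pointwise one on the pairs that
carry positive weight. -/
theorem of_ae (h : IsStationaryReversibleMarkovChain P a Z) {R : Fin n → Fin n → Prop}
    (hR : ∀ᵐ ω ∂P, R (Z 0 ω) (Z 1 ω)) (i j : Fin n)
    (hij : P.real {ω | Z 0 ω = i} * a i j ≠ 0) : R i j := by
  by_contra hn
  refine hij ?_
  have := h.measureReal_pair 1 i j
  rw [pow_one] at this
  rw [← this, measureReal_eq_zero_iff]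
  refine measure_mono_null ?_ hR
  rintro ω ⟨h0, h1⟩ hω
  exact hn (h0 ▸ h1 ▸ hω)

end IsStationaryReversibleMarkovChain

/-! ### Failure of Enflo type above 1 -/

/-- The element of `ℤ ≀ ℤ` at position `0` with lamp `c j` at `j` for `0 ≤ j < n`. -/
def rowOfLamps {n : ℕ} (c : Fin n → ℤ) : ZwrZ where
  lamp z := if h : (Multiplicative.toAdd z).toNat < n ∧ 0 ≤ Multiplicative.toAdd z then
    Multiplicative.ofAdd (c ⟨(Multiplicative.toAdd z).toNat, h.1⟩) else 1
  pos := 1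
  finite_support := by
    refine ((Set.finite_Ico (0 : ℤ) n).preimage
      (Multiplicative.toAdd.injective.injOn (s := Set.univ) |>.mono (Set.subset_univ _))).subset ?_
    intro z hz
    by_contra h
    simp only [Set.mem_preimage, Set.mem_Ico] at h
    exact hz (dif_neg (by omega))

theorem lampInt_rowOfLamps {n : ℕ} (c : Fin n → ℤ) (j : Fin n) :
    lampInt (rowOfLamps c) j = c j := by
  simp [lampInt, rowOfLamps]

theorem lampInt_rowOfLamps_of_notMem {n : ℕ} (c : Fin n → ℤ) {z : ℤ} (hz : ¬ (0 ≤ z ∧ z < n)) :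
    lampInt (rowOfLamps c) z = 0 := by
  simp only [lampInt, rowOfLamps, toAdd_ofAdd]
  rw [dif_neg (by omega), toAdd_one]

theorem dist_rowOfLamps_le {n : ℕ} (c c' : Fin n → ℤ) :
    dist (rowOfLamps c) (rowOfLamps c') ≤ 2 * n + ∑ j, |((c' j - c j : ℤ) : ℝ)| := by
  have h := dist_le_sweep (rowOfLamps c) (rowOfLamps c') 0 n fun z hz => by
    rw [zero_add] at hz
    rw [lampInt_rowOfLamps_of_notMem c hz, lampInt_rowOfLamps_of_notMem c' hz]
  have h0 : ∀ c : Fin n → ℤ, posInt (rowOfLamps c) = 0 := fun _ => rfl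
  rw [Finset.sum_range] at h
  simp only [h0, zero_add, lampInt_rowOfLamps, sub_self, Int.cast_zero, abs_zero, zero_sub,
    Int.cast_neg, Int.cast_natCast, abs_neg, Nat.abs_cast] at h
  linarith

theorem le_dist_rowOfLamps {n : ℕ} (c c' : Fin n → ℤ) :
    ∑ j, |((c j - c' j : ℤ) : ℝ)| ≤ dist (rowOfLamps c) (rowOfLamps c') := by
  refine le_trans (le_of_eq ?_) (sum_abs_lampInt_sub_le
    (Finset.univ.image fun j : Fin n => ((j : ℕ) : ℤ)) _ _)
  rw [Finset.sum_image]
  · simp only [lampInt_rowOfLamps]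
  · intro i _ j _ h
    exact Fin.ext (Int.ofNat_injective h)

theorem not_hasEnfloType_ZwrZ {p : ℝ} (hp : 1 < p) : ¬ HasEnfloType ZwrZ p := by
  rintro ⟨K, hK, h⟩
  have key : ∀ n : ℕ, 1 ≤ n → (n : ℝ) ^ (p - 1) ≤ (2 * K) ^ p := by
    intro n hn
    have hn0 : (0 : ℝ) < n := by exact_mod_cast hn
    have hp0 : 0 ≤ p := by linarith
    have h1 := h n fun ε => rowOfLamps fun j => n * (ε j : ℤ)
    -- Each of the n lamps changes by 2n between antipodes; along an edge a single lamp changes by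
    -- 2n and the walk costs 2n more. The inequality then forces n^(p-1) to stay bounded.
    have hlow : (2 * (n : ℝ) ^ 2) ^ p ≤ 𝔼 ε : Fin n → ℤˣ,
        dist (rowOfLamps fun j => n * (ε j : ℤ)) (rowOfLamps fun j => n * ((-ε) j : ℤ)) ^ p := by
      refine Finset.le_expect Finset.univ_nonempty fun ε _ => ?_
      refine Real.rpow_le_rpow (by positivity) (le_trans ?_ (le_dist_rowOfLamps _ _)) hp0
      have : ∀ j, |((n * (ε j : ℤ) - n * ((-ε) j : ℤ) : ℤ) : ℝ)| = 2 * n := by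
        intro j
        rcases Int.units_eq_one_or (ε j) with h | h <;> simp [h] <;> ring_nf <;> simp
      simp only [this]
      simp; nlinarith
    have hup : ∀ j : Fin n, (𝔼 ε : Fin n → ℤˣ, dist (rowOfLamps fun i => n * (ε i : ℤ))
        (rowOfLamps fun i => n * (Function.update ε j (-ε j) i : ℤ)) ^ p) ≤ (4 * (n : ℝ)) ^ p := by
      intro j
      refine Finset.expect_le Finset.univ_nonempty fun ε _ => ?_
      refine Real.rpow_le_rpow dist_nonneg ((dist_rowOfLamps_le _ _).trans ?_) hp0
      rw [Finset.sum_eq_single j]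
      · rw [Function.update_self]
        have : |((n * ((-ε j : ℤˣ) : ℤ) - n * (ε j : ℤ) : ℤ) : ℝ)| = 2 * n := by
          rcases Int.units_eq_one_or (ε j) with h | h <;> simp [h] <;> ring_nf <;> simp
        linarith
      · intro i _ hi
        rw [Function.update_of_ne hi]; simp
      · simp
    have h2 : (2 * (n : ℝ) ^ 2) ^ p ≤ K ^ p * (n * (4 * (n : ℝ)) ^ p) := by
      refine (hlow.trans h1).trans (mul_le_mul_of_nonneg_left ?_ (by positivity))
      refine (Finset.sum_le_sum fun j _ => hup j).trans_eq ?_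
      simp
    have e1 : (2 * (n : ℝ) ^ 2) ^ p = (2 * n) ^ p * (n : ℝ) ^ (p - 1) * n := by
      rw [show 2 * (n : ℝ) ^ 2 = 2 * n * n by ring, Real.mul_rpow (by positivity) hn0.le, mul_assoc]
      congr 1
      nth_rewrite 3 [← Real.rpow_one (n : ℝ)]
      rw [← Real.rpow_add hn0]; ring_nf
    have e2 : K ^ p * (n * (4 * (n : ℝ)) ^ p) = (2 * n) ^ p * (2 * K) ^ p * n := by
      rw [show 4 * (n : ℝ) = 2 * n * 2 by ring, Real.mul_rpow (by positivity) (by norm_num),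
        Real.mul_rpow (x := 2) (by norm_num) hK.le]
      ring
    rw [e1, e2] at h2
    exact le_of_mul_le_mul_left (le_of_mul_le_mul_right h2 hn0) (by positivity)
  have ht : Filter.Tendsto (fun n : ℕ => (n : ℝ) ^ (p - 1)) Filter.atTop Filter.atTop :=
    (tendsto_rpow_atTop (by linarith)).comp tendsto_natCast_atTop_atTop
  obtain ⟨n, hn, hn'⟩ := ((ht.eventually_gt_atTop ((2 * K) ^ p)).and
    (Filter.eventually_ge_atTop 1)).exists
  exact absurd (key n hn') (not_le.2 hn)

/-! ### The Hilbert space embedding is Lipschitz -/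

theorem Int.cast_eq_one_or_neg_one_sq {k : ℤ} (hk : k = 1 ∨ k = -1) : ((k : ℝ)) ^ 2 = 1 := by
  rcases hk with rfl | rfl <;> norm_num

/-- The finitely many coordinates form a map to a Euclidean space, whose Lipschitz constant is read
off on edges and propagated along a geodesic. -/
theorem sum_sq_sub_le_of_isStep {I : Type*} (F : I → ZwrZ → ℝ) {L : ℝ} (hL : 0 ≤ L)
    (S : Finset I) (h : ∀ u v k, (k = 1 ∨ k = -1) → IsStep k u v →
      ∑ i ∈ S, (F i u - F i v) ^ 2 ≤ L) (u v : ZwrZ) :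
    ∑ i ∈ S, (F i u - F i v) ^ 2 ≤ L * dist u v ^ 2 := by
  have hd : ∀ u v, dist (WithLp.toLp 2 fun i : S => F i u : EuclideanSpace ℝ S)
      (WithLp.toLp 2 fun i : S => F i v) = √(∑ i ∈ S, (F i u - F i v) ^ 2) := by
    intro u v
    rw [EuclideanSpace.dist_eq, ← Finset.sum_coe_sort S]
    simp only [Real.dist_eq, sq_abs]
  have := dist_le_mul_of_isStep
    (fun u => (WithLp.toLp 2 fun i : S => F i u : EuclideanSpace ℝ S)) (√L)
    (fun u v k hk hs => by rw [hd]; exact Real.sqrt_le_sqrt (h u v k hk hs)) u v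
  rw [hd, Real.sqrt_le_iff, mul_pow, Real.sq_sqrt hL] at this
  exact this.2

theorem posInt_sub_sq_le (u v : ZwrZ) :
    ((posInt u : ℝ) - posInt v) ^ 2 ≤ 1 * dist u v ^ 2 := by
  have := sum_sq_sub_le_of_isStep (fun _ : Unit => fun u => (posInt u : ℝ)) zero_le_one
    Finset.univ ?_ u v
  · simpa using this
  · intro u v k hk hs
    simp only [Finset.univ_unique, Finset.sum_const, Finset.card_singleton, one_smul]
    rcases hs with ⟨h, -⟩ | ⟨h, -⟩
    · rw [h]; push_cast
      linarith [Int.cast_eq_one_or_neg_one_sq hk]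
    · rw [h]; simp

theorem sum_lampInt_sub_sq_le (S : Finset ℤ) (u v : ZwrZ) :
    ∑ z ∈ S, ((lampInt u z : ℝ) - lampInt v z) ^ 2 ≤ 1 * dist u v ^ 2 := by
  refine sum_sq_sub_le_of_isStep (fun z u => (lampInt u z : ℝ)) zero_le_one S ?_ u v
  intro u v k hk hs
  rcases hs with ⟨-, h⟩ | ⟨-, h⟩
  · simp [h]
  · have : ∀ z ∈ S, ((lampInt u z : ℝ) - lampInt v z) ^ 2 = if z = posInt u then 1 else 0 := by
      intro z _
      rw [h]; push_cast
      split_ifs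
      · linarith [Int.cast_eq_one_or_neg_one_sq hk]
      · simp
    rw [Finset.sum_congr rfl this, Finset.sum_ite_eq']
    split_ifs <;> norm_num

/-- The weight `max r 0 ^ β`. -/
noncomputable def rampWeight (β : ℝ) (r : ℤ) : ℝ := (r.toNat : ℝ) ^ β

theorem rampWeight_of_nonpos {β : ℝ} (hβ : 0 < β) {r : ℤ} (hr : r ≤ 0) : rampWeight β r = 0 := by
  rw [rampWeight, Int.toNat_of_nonpos hr, Nat.cast_zero, Real.zero_rpow hβ.ne']

/-- The increment at r > 0 is at most r^(β-1), whose square is summable because 2 - 2β > 1. -/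
theorem summable_rampWeight_sub_sq {β : ℝ} (hβ : 0 < β) (hβ' : β < 1 / 2) :
    Summable fun r : ℤ => (rampWeight β (r + 1) - rampWeight β r) ^ 2 := by
  rw [← (Nat.cast_injective (R := ℤ)).summable_iff]
  -- The term r = 0, where r^(β-1) is no bound, is dropped.
  · rw [← summable_nat_add_iff 1]
    have hs : Summable fun r : ℕ => ((r : ℝ) ^ (2 - 2 * β))⁻¹ :=
      Real.summable_nat_rpow_inv.2 (by linarith)
    refine Summable.of_nonneg_of_le (fun _ => sq_nonneg _) (fun r => ?_)
      ((summable_nat_add_iff 1).2 hs)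
    have hr : (0 : ℝ) < ((r + 1 : ℕ) : ℝ) := by positivity
    set x : ℝ := ((r + 1 : ℕ) : ℝ) with hx
    have e1 : rampWeight β (((r + 1 : ℕ) : ℤ) + 1) = (x + 1) ^ β := by
      rw [rampWeight, show (((r + 1 : ℕ) : ℤ) + 1).toNat = r + 1 + 1 by omega, hx]; push_cast; rfl
    have e2 : rampWeight β ((r + 1 : ℕ) : ℤ) = x ^ β := by
      rw [rampWeight, Int.toNat_natCast]
    simp only [Function.comp_apply]
    rw [e1, e2]
    have h0 : x ^ β ≤ (x + 1) ^ β := Real.rpow_le_rpow hr.le (by linarith) hβ.le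
    have h1 : (x + 1) ^ β ≤ x ^ β + x ^ (β - 1) := by
      have : x + 1 = x * (1 + 1 / x) := by field_simp
      rw [this, Real.mul_rpow hr.le (by positivity), Real.rpow_sub_one hr.ne']
      have hb := rpow_one_add_le_one_add_mul_self (s := 1 / x) (p := β)
        (by have : 0 < 1 / x := by positivity
            linarith) hβ.le (by linarith)
      have h2 : x ^ β * (1 + 1 / x) ^ β ≤ x ^ β * (1 + β * (1 / x)) := by gcongr
      have h3 : β * (1 / x) ≤ 1 * (1 / x) := by gcongr; linarith
      have h4 : x ^ β * (1 + β * (1 / x)) ≤ x ^ β * (1 + 1 * (1 / x)) := by gcongr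
      refine h2.trans (h4.trans_eq ?_)
      ring
    have h2 : (x ^ (2 - 2 * β))⁻¹ = (x ^ (β - 1)) ^ 2 := by
      rw [← Real.rpow_neg hr.le, ← Real.rpow_natCast, ← Real.rpow_mul hr.le]
      congr 1; push_cast; ring
    rw [h2]
    exact pow_le_pow_left₀ (by linarith) (by linarith) 2
  · intro r hr
    have : r < 0 := by
      by_contra h
      exact hr ⟨r.toNat, by simp; omega⟩
    rw [rampWeight_of_nonpos hβ (by omega), rampWeight_of_nonpos hβ (by omega)]; simp

theorem sum_rampWeight_sub_sq_le {β : ℝ} (hβ : 0 < β) (hβ' : β < 1 / 2) (T : Finset ℤ) (c : ℤ) :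
    ∑ z ∈ T, (rampWeight β (z - c + 1) - rampWeight β (z - c)) ^ 2 ≤
      ∑' r : ℤ, (rampWeight β (r + 1) - rampWeight β r) ^ 2 := by
  have := (summable_rampWeight_sub_sq hβ hβ').sum_le_tsum
    (T.map (Equiv.subRight c).toEmbedding) (fun _ _ => sq_nonneg _)
  rw [Finset.sum_map] at this
  exact this

/-- The lamps of `u`, reflected by the sign `σ`, on the half-line `[z, ∞)`. -/
def halfLamp (σ : ℤˣ) (u : ZwrZ) (z : ℤ) : ℤ → ℤ := fun t => if z ≤ t then lampInt u (σ * t) else 0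

open Classical in
/-- The coordinates of the half-line embedding of `ℤ ≀ ℤ`. -/
noncomputable def halfLineCoord (β : ℝ) (i : ℤˣ × ℤ × (ℤ → ℤ)) (u : ZwrZ) : ℝ :=
  if halfLamp i.1 u i.2.1 = i.2.2 then rampWeight β (i.2.1 - i.1 * posInt u) else 0

theorem Int.units_mul_eq_iff (σ : ℤˣ) (x y : ℤ) : σ * x = y ↔ x = σ * y := by
  rcases Int.units_eq_one_or σ with rfl | rfl
  · simp
  · simp only [Units.val_neg, Units.val_one]; omega

/-- The weight vanishes exactly where the half-line contains the walker, so a lamp step changes no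
coordinate. A move changes, for each sign and each endpoint z, only the coordinate labelled by the
current configuration. The factor 2 counts the signs. -/
theorem sum_halfLineCoord_sub_sq_le {β : ℝ} (hβ : 0 < β) (hβ' : β < 1 / 2)
    (S : Finset (ℤˣ × ℤ × (ℤ → ℤ))) (u v : ZwrZ) :
    ∑ i ∈ S, (halfLineCoord β i u - halfLineCoord β i v) ^ 2 ≤
      (2 * ∑' r : ℤ, (rampWeight β (r + 1) - rampWeight β r) ^ 2) * dist u v ^ 2 := by
  classical
  have hA : 0 ≤ ∑' r : ℤ, (rampWeight β (r + 1) - rampWeight β r) ^ 2 :=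
    tsum_nonneg fun _ => sq_nonneg _
  refine sum_sq_sub_le_of_isStep (halfLineCoord β) (by positivity) S ?_ u v
  intro u v k hk hs
  rcases hs with ⟨hp, hl⟩ | ⟨hp, hl⟩
  · have hhalf : ∀ σ z, halfLamp σ v z = halfLamp σ u z := by
      intro σ z
      funext t
      simp only [halfLamp, hl]
    set T := S.image fun i => i.2.1
    set W := S.image fun i => i.2.2
    -- Enlarging `S` to a box allows summing over the configurations first, for fixed sign and
    -- endpoint.
    have hsub : S ⊆ Finset.univ ×ˢ (T ×ˢ W) := by
      intro i hi
      exact Finset.mem_product.2 ⟨Finset.mem_univ _, Finset.mem_product.2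
        ⟨Finset.mem_image_of_mem _ hi, Finset.mem_image_of_mem _ hi⟩⟩
    refine (Finset.sum_le_sum_of_subset_of_nonneg hsub fun _ _ _ => sq_nonneg _).trans ?_
    rw [Finset.sum_product]
    have hσ : ∀ σ : ℤˣ, ∑ q ∈ T ×ˢ W,
        (halfLineCoord β (σ, q) u - halfLineCoord β (σ, q) v) ^ 2 ≤
          ∑' r : ℤ, (rampWeight β (r + 1) - rampWeight β r) ^ 2 := by
      intro σ
      rw [Finset.sum_product]
      have hz : ∀ z ∈ T, ∑ w ∈ W,
          (halfLineCoord β (σ, z, w) u - halfLineCoord β (σ, z, w) v) ^ 2 ≤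
            (rampWeight β (z - σ * posInt u) - rampWeight β (z - σ * posInt v)) ^ 2 := by
        intro z _
        have : ∀ w ∈ W, (halfLineCoord β (σ, z, w) u - halfLineCoord β (σ, z, w) v) ^ 2 =
            if halfLamp σ u z = w then
              (rampWeight β (z - σ * posInt u) - rampWeight β (z - σ * posInt v)) ^ 2 else 0 := by
          intro w _
          simp only [halfLineCoord, hhalf]
          split_ifs <;> simp
        rw [Finset.sum_congr rfl this, Finset.sum_ite_eq]
        split_ifs
        · exact le_rfl
        · exact sq_nonneg _
      refine (Finset.sum_le_sum hz).trans ?_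
      have hc : (σ : ℤ) * posInt v = σ * posInt u + 1 ∨ (σ : ℤ) * posInt u = σ * posInt v + 1 := by
        rw [hp]
        rcases Int.units_eq_one_or σ with rfl | rfl <;> rcases hk with rfl | rfl <;>
          simp only [Units.val_neg, Units.val_one] <;> omega
      rcases hc with hc | hc
      · refine le_trans (le_of_eq ?_) (sum_rampWeight_sub_sq_le hβ hβ' T (σ * posInt v))
        refine Finset.sum_congr rfl fun z _ => ?_
        rw [hc]; ring_nf
      · refine le_trans (le_of_eq ?_) (sum_rampWeight_sub_sq_le hβ hβ' T (σ * posInt u))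
        refine Finset.sum_congr rfl fun z _ => ?_
        rw [hc]; ring_nf
    refine (Finset.sum_le_sum fun σ _ => hσ σ).trans_eq ?_
    simp
  · refine le_trans (le_of_eq ?_) (by positivity : (0 : ℝ) ≤ _)
    refine Finset.sum_eq_zero fun ⟨σ, z, w⟩ _ => ?_
    simp only [halfLineCoord, hp]
    -- Either the half-line contains the walker and both weights are zero, or the altered lamp lies
    -- outside it.
    by_cases hz : z ≤ σ * posInt u
    · rw [rampWeight_of_nonpos hβ (by omega)]; simp
    · have : halfLamp σ v z = halfLamp σ u z := by
        funext t
        simp only [halfLamp]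
        by_cases ht : z ≤ t
        · rw [if_pos ht, if_pos ht, hl, if_neg, add_zero]
          rw [Int.units_mul_eq_iff]; omega
        · rw [if_neg ht, if_neg ht]
      rw [this]; simp

/-! ### Lower bound for the embedding -/

/-- Induction on `M`; Bernoulli's inequality bounds the increment of x^(1+γ) by (1 + γ) x^γ ≤ 2 x^γ.
-/
theorem rpow_one_add_div_two_le_sum {γ : ℝ} (hγ : 0 ≤ γ) (hγ' : γ ≤ 1) (M : ℕ) :
    (M : ℝ) ^ (1 + γ) / 2 ≤ ∑ r ∈ Finset.range M, ((r + 1 : ℕ) : ℝ) ^ γ := by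
  induction M with
  | zero => simp [Real.zero_rpow (by linarith : 1 + γ ≠ 0)]
  | succ M ih =>
    rw [Finset.sum_range_succ]
    set x : ℝ := ((M + 1 : ℕ) : ℝ) with hx
    have hx1 : 1 ≤ x := by rw [hx]; push_cast; linarith [Nat.cast_nonneg (α := ℝ) M]
    have hx0 : 0 < x := by linarith
    have hM : (M : ℝ) = x * (1 + -(1 / x)) := by rw [hx]; push_cast; field_simp; ring
    have h1x : 1 / x ≤ 1 := by rw [div_le_one hx0]; exact hx1
    have hb := one_add_mul_self_le_rpow_one_add (s := -(1 / x)) (p := 1 + γ) (by linarith)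
      (by linarith)
    have h1 : x ^ (1 + γ) * (1 + (1 + γ) * -(1 / x)) ≤ (M : ℝ) ^ (1 + γ) := by
      rw [hM, Real.mul_rpow hx0.le (by linarith)]
      gcongr
    have h2 : x ^ (1 + γ) = x * x ^ γ := by rw [Real.rpow_add hx0, Real.rpow_one]
    have h3 : x ^ (1 + γ) * (1 + (1 + γ) * -(1 / x)) = x ^ (1 + γ) - (1 + γ) * x ^ γ := by
      rw [h2]; field_simp; ring
    have h4 : (1 + γ) * x ^ γ ≤ 2 * x ^ γ := by gcongr; linarith
    linarith

/-- For each endpoint at distance r + 1 ≤ M ahead of `u`, the half-line contains the differing lamp.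
The coordinate labelled by the configuration of `u` is then (r + 1)^β at `u` and 0 at `v`, wherever
`v` stands. -/
theorem exists_halfLine_lower {β : ℝ} (hβ : 0 < β) (hβ' : β < 1 / 2) (u v : ZwrZ) (σ : ℤˣ)
    (M : ℕ) (h : lampInt u (posInt u + σ * M) ≠ lampInt v (posInt u + σ * M)) :
    ∃ S : Finset (ℤˣ × ℤ × (ℤ → ℤ)), (M : ℝ) ^ (1 + 2 * β) / 2 ≤
      ∑ i ∈ S, (halfLineCoord β i u - halfLineCoord β i v) ^ 2 := by
  classical
  refine ⟨(Finset.range M).image fun r : ℕ => (σ, σ * posInt u + (r + 1),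
    halfLamp σ u (σ * posInt u + (r + 1))), ?_⟩
  rw [Finset.sum_image]
  · refine (rpow_one_add_div_two_le_sum (by linarith) (by linarith) M).trans_eq ?_
    refine Finset.sum_congr rfl fun r hr => ?_
    have hr := Finset.mem_range.1 hr
    have hne : halfLamp σ v (σ * posInt u + (r + 1)) ≠ halfLamp σ u (σ * posInt u + (r + 1)) := by
      intro heq
      have := congrFun heq (σ * posInt u + M)
      have e : (σ : ℤ) * (σ * posInt u + M) = posInt u + σ * M := by
        rw [mul_add, ← mul_assoc, Int.units_coe_mul_self, one_mul]
      simp only [halfLamp] at this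
      rw [if_pos (by omega), if_pos (by omega), e] at this
      exact h this.symm
    rw [halfLineCoord, halfLineCoord, if_pos rfl, if_neg hne, sub_zero, rampWeight,
      show (σ * posInt u + ((r : ℤ) + 1) - σ * posInt u).toNat = r + 1 by omega,
      ← Real.rpow_natCast, ← Real.rpow_mul (by positivity)]
    congr 1; push_cast; ring
  · intro r _ r' _ h
    simp only [Prod.mk.injEq] at h
    omega

/-- The squared distance of `u` and `v` in the embedding, restricted to finitely many
coordinates. -/
noncomputable def coordSqDist (β : ℝ) (S : Finset ℤ) (S' : Finset (ℤˣ × ℤ × (ℤ → ℤ)))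
    (u v : ZwrZ) : ℝ :=
  ((posInt u : ℝ) - posInt v) ^ 2 + ∑ z ∈ S, ((lampInt u z : ℝ) - lampInt v z) ^ 2 +
    ∑ i ∈ S', (halfLineCoord β i u - halfLineCoord β i v) ^ 2

/-- The least admissible radius: if it exceeds 1, then something must happen at distance exactly
`M`, either the other position or a differing lamp. -/
theorem exists_radius (u v : ZwrZ) : ∃ M : ℕ, 1 ≤ M ∧ |posInt u - posInt v| ≤ M ∧
    (∀ z, (M : ℤ) < |z - posInt u| → lampInt u z = lampInt v z) ∧
    (M = 1 ∨ |posInt u - posInt v| = M ∨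
      ∃ σ : ℤˣ, lampInt u (posInt u + σ * M) ≠ lampInt v (posInt u + σ * M)) := by
  classical
  have hex : ∃ M : ℕ, 1 ≤ M ∧ |posInt u - posInt v| ≤ M ∧
      (∀ z, (M : ℤ) < |z - posInt u| → lampInt u z = lampInt v z) := by
    obtain ⟨B, hB⟩ := ((finite_lampInt_ne u v).image fun z => |z - posInt u|).bddAbove
    refine ⟨1 + (|posInt u - posInt v|).toNat + B.toNat, by omega, by push_cast; omega,
      fun z hz => ?_⟩
    by_contra hne
    have := hB (Set.mem_image_of_mem _ hne)
    push_cast at hz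
    omega
  obtain ⟨h1, h2, h3⟩ := Nat.find_spec hex
  set M := Nat.find hex with hM
  refine ⟨M, h1, h2, h3, ?_⟩
  by_contra! hcon
  obtain ⟨c1, c2, c3⟩ := hcon
  refine Nat.find_min hex (m := M - 1) (by omega) ⟨by omega, by omega, fun z hz => ?_⟩
  by_cases hz' : (M : ℤ) < |z - posInt u|
  · exact h3 z hz'
  · have hz2 : |z - posInt u| = M := by omega
    rcases abs_choice (z - posInt u) with h | h
    · have := c3 1
      rwa [show posInt u + ((1 : ℤˣ) : ℤ) * M = z by simp; omega] at this
    · have := c3 (-1)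
      rwa [show posInt u + ((-1 : ℤˣ) : ℤ) * M = z by simp; omega] at this

theorem one_le_cast_sub_sq {m n : ℤ} (h : m ≠ n) : (1 : ℝ) ≤ ((m : ℝ) - n) ^ 2 := by
  have h0 : m - n ≠ 0 := sub_ne_zero.2 h
  have : (1 : ℤ) ≤ (m - n) ^ 2 := by
    have := sq_pos_of_ne_zero h0
    omega
  exact_mod_cast this

/-- Here n is the distance, s the ℓ¹ distance of the lamps and Q the squared distance of the images.
If n^(2/3) ≤ 14 M, the bound by M^(3α) suffices, with 392 = 2 · 14². Otherwise 7 M < n/2, so s ≥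
n/2, and s² ≤ 3 M Q yields n^(4/3) ≤ Q. -/
theorem rpow_le_of_radius_bounds {α n s M Q : ℝ} (hα : 0 < α) (hα' : α ≤ 2 / 3)
    (hn : 1 ≤ n) (hM : 1 ≤ M) (hs : n ≤ s + 7 * M) (hQ : M ^ (3 * α) / 2 ≤ Q)
    (hsQ : s ^ 2 ≤ 3 * M * Q) : n ^ (2 * α) ≤ 392 * Q := by
  have hn0 : 0 < n := by linarith
  have hQ0 : 0 ≤ Q := le_trans (by positivity) hQ
  rcases le_or_gt (n ^ (2 / 3 : ℝ)) (14 * M) with h | h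
  · have h1 : (n ^ (2 / 3 : ℝ)) ^ (3 * α) ≤ (14 * M) ^ (3 * α) :=
      Real.rpow_le_rpow (by positivity) h (by positivity)
    rw [← Real.rpow_mul hn0.le, show 2 / 3 * (3 * α) = 2 * α by ring,
      Real.mul_rpow (by norm_num) (by linarith)] at h1
    have h2 : (14 : ℝ) ^ (3 * α) ≤ 196 := by
      calc (14 : ℝ) ^ (3 * α) ≤ 14 ^ (2 : ℝ) :=
            Real.rpow_le_rpow_of_exponent_le (by norm_num) (by linarith)
        _ = 196 := by norm_num
    have h3 : (14 : ℝ) ^ (3 * α) * M ^ (3 * α) ≤ 196 * M ^ (3 * α) := by gcongr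
    linarith
  · have h1 : n ^ (2 / 3 : ℝ) ≤ n := by
      calc n ^ (2 / 3 : ℝ) ≤ n ^ (1 : ℝ) :=
            Real.rpow_le_rpow_of_exponent_le hn (by norm_num)
        _ = n := Real.rpow_one n
    have h2 : n / 2 ≤ s := by linarith
    have h3 : (n / 2) ^ 2 ≤ s ^ 2 := by gcongr
    have h4 : 3 * M * Q ≤ 3 * (n ^ (2 / 3 : ℝ) / 14) * Q := by gcongr; linarith
    have h5 : n ^ 2 = n ^ (4 / 3 : ℝ) * n ^ (2 / 3 : ℝ) := by
      rw [← Real.rpow_add hn0, ← Real.rpow_natCast]; norm_num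
    have h6 : n ^ (2 * α) ≤ n ^ (4 / 3 : ℝ) :=
      Real.rpow_le_rpow_of_exponent_le hn (by linarith)
    have hpos : 0 < n ^ (2 / 3 : ℝ) := by positivity
    have h7 : n ^ (4 / 3 : ℝ) * n ^ (2 / 3 : ℝ) ≤ Q * n ^ (2 / 3 : ℝ) := by
      rw [← h5]
      nlinarith [mul_nonneg hQ0 hpos.le]
    have := le_of_mul_le_mul_right h7 hpos
    linarith

theorem one_le_dist_of_ne {u v : ZwrZ} (h : u ≠ v) : 1 ≤ dist u v := by
  change (1 : ℝ) ≤ (cayleyZwrZ.dist u v : ℝ)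
  exact_mod_cast cayleyZwrZ_connected.pos_dist_of_ne h

theorem exists_rpow_dist_le_of_half_le {α : ℝ} (hα : 1 / 2 ≤ α) (hα' : α < 2 / 3) {u v : ZwrZ}
    (huv : u ≠ v) : ∃ S S', dist u v ^ (2 * α) ≤ 392 * coordSqDist ((3 * α - 1) / 2) S S' u v := by
  classical
  set β := (3 * α - 1) / 2 with hβdef
  have hβ : 0 < β := by rw [hβdef]; linarith
  have hβ' : β < 1 / 2 := by rw [hβdef]; linarith
  have hexp : 1 + 2 * β = 3 * α := by rw [hβdef]; ring
  obtain ⟨M, hM1, hM2, hM3, hM4⟩ := exists_radius u v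
  -- This is the interval of radius `M` around the position of `u`, which contains all differing
  -- lamps.
  set S := (Finset.range (2 * M + 1)).image fun j : ℕ => posInt u - M + (j : ℤ) with hS
  have hsumS : ∀ F : ℤ → ℝ,
      ∑ z ∈ S, F z = ∑ j ∈ Finset.range (2 * M + 1), F (posInt u - M + (j : ℤ)) := by
    intro F
    rw [hS, Finset.sum_image]
    intro i _ j _ h
    simp only at h
    omega
  have hMR : (1 : ℝ) ≤ M := by exact_mod_cast hM1
  have hpn : ∀ S S', 0 ≤ ((posInt u : ℝ) - posInt v) ^ 2 ∧
      0 ≤ ∑ z ∈ S, ((lampInt u z : ℝ) - lampInt v z) ^ 2 ∧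
      0 ≤ ∑ i ∈ S', (halfLineCoord β i u - halfLineCoord β i v) ^ 2 := fun S S' =>
    ⟨sq_nonneg _, Finset.sum_nonneg fun _ _ => sq_nonneg _,
      Finset.sum_nonneg fun _ _ => sq_nonneg _⟩
  have hlow : ∃ S', (M : ℝ) ^ (3 * α) / 2 ≤ coordSqDist β S S' u v := by
    rcases hM4 with h | h | ⟨σ, h⟩
    · refine ⟨∅, ?_⟩
      obtain ⟨n1, n2, n3⟩ := hpn S ∅
      suffices h' : 1 ≤ coordSqDist β S ∅ u v by
        rw [h, Nat.cast_one, Real.one_rpow]; linarith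
      unfold coordSqDist
      by_cases hp : posInt u = posInt v
      · have : ∃ z, lampInt u z ≠ lampInt v z := by
          by_contra! hall
          exact huv (ZwrZ.ext_int hp hall)
        obtain ⟨z, hz⟩ := this
        have hzS : z ∈ S := by
          have : |z - posInt u| ≤ M := not_lt.1 fun hlt => hz (hM3 z hlt)
          rw [abs_le] at this
          exact Finset.mem_image.2 ⟨(z - (posInt u - M)).toNat,
            Finset.mem_range.2 (by omega), by omega⟩
        have h1 := Finset.single_le_sum
          (f := fun z => ((lampInt u z : ℝ) - lampInt v z) ^ 2) (fun _ _ => sq_nonneg _) hzS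
        have h2 := one_le_cast_sub_sq hz
        linarith
      · have := one_le_cast_sub_sq hp
        linarith
    · refine ⟨∅, ?_⟩
      obtain ⟨n1, n2, n3⟩ := hpn S ∅
      unfold coordSqDist
      have e : ((posInt u : ℝ) - posInt v) ^ 2 = (M : ℝ) ^ 2 := by
        rw [← sq_abs]
        congr 1
        exact_mod_cast h
      -- The position coordinate alone contributes M², which is enough because 3α ≤ 2.
      have h1 : (M : ℝ) ^ (3 * α) ≤ (M : ℝ) ^ (2 : ℝ) :=
        Real.rpow_le_rpow_of_exponent_le hMR (by linarith)
      rw [Real.rpow_two] at h1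
      have : 0 ≤ (M : ℝ) ^ 2 := by positivity
      linarith
    · obtain ⟨S', hS'⟩ := exists_halfLine_lower hβ hβ' u v σ M h
      refine ⟨S', ?_⟩
      obtain ⟨n1, n2, n3⟩ := hpn S S'
      unfold coordSqDist
      rw [hexp] at hS'
      linarith
  obtain ⟨S', hS'⟩ := hlow
  obtain ⟨n1, n2, n3⟩ := hpn S S'
  refine ⟨S, S', rpow_le_of_radius_bounds (by linarith) hα'.le (one_le_dist_of_ne huv) hMR
    (s := ∑ z ∈ S, |((lampInt v z - lampInt u z : ℤ) : ℝ)|) ?_ hS' ?_⟩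
  -- The walks and the sweep cost at most M + (2M + 1) + (2M + 1) ≤ 7M.
  · have := dist_le_sweep u v (posInt u - M) (2 * M + 1) fun z hz => hM3 z <| by
      push_cast at hz
      rw [lt_abs]; omega
    rw [← hsumS fun z => |((lampInt v z - lampInt u z : ℤ) : ℝ)|] at this
    have b1 : |((posInt u - M - posInt u : ℤ) : ℝ)| ≤ M := by
      rw [show posInt u - M - posInt u = -(M : ℤ) by ring]; simp
    have b2 : |((posInt v - (posInt u - M + ((2 * M + 1 : ℕ) : ℤ)) : ℤ) : ℝ)| ≤ 2 * M + 1 := by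
      have : |posInt v - (posInt u - M + ((2 * M + 1 : ℕ) : ℤ))| ≤ 2 * M + 1 := by
        push_cast
        rw [abs_le] at hM2 ⊢
        constructor <;> omega
      exact_mod_cast this
    have b3 : ((2 * M + 1 : ℕ) : ℝ) = 2 * M + 1 := by push_cast; rfl
    linarith
  · have h1 := sq_sum_le_card_mul_sum_sq (s := S)
      (f := fun z => |((lampInt v z - lampInt u z : ℤ) : ℝ)|)
    have h2 : (S.card : ℝ) ≤ 3 * M := by
      have : S.card ≤ 2 * M + 1 := Finset.card_image_le.trans_eq (Finset.card_range _)
      have : (S.card : ℝ) ≤ 2 * M + 1 := by exact_mod_cast this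
      linarith
    have h3 : ∑ z ∈ S, |((lampInt v z - lampInt u z : ℤ) : ℝ)| ^ 2 ≤ coordSqDist β S S' u v := by
      have : ∑ z ∈ S, |((lampInt v z - lampInt u z : ℤ) : ℝ)| ^ 2 =
          ∑ z ∈ S, ((lampInt u z : ℝ) - lampInt v z) ^ 2 := by
        refine Finset.sum_congr rfl fun z _ => ?_
        rw [sq_abs]; push_cast; ring
      rw [this, coordSqDist]
      linarith
    refine h1.trans (mul_le_mul h2 h3 ?_ (by positivity))
    exact Finset.sum_nonneg fun _ _ => sq_nonneg _

theorem coordSqDist_mono {β : ℝ} {S T : Finset ℤ} {S' T' : Finset (ℤˣ × ℤ × (ℤ → ℤ))}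
    (h : S ⊆ T) (h' : S' ⊆ T') (u v : ZwrZ) : coordSqDist β S S' u v ≤ coordSqDist β T T' u v := by
  unfold coordSqDist
  gcongr

theorem coordSqDist_nonneg (β : ℝ) (S : Finset ℤ) (S' : Finset (ℤˣ × ℤ × (ℤ → ℤ)))
    (u v : ZwrZ) : 0 ≤ coordSqDist β S S' u v :=
  add_nonneg (add_nonneg (sq_nonneg _) (Finset.sum_nonneg fun _ _ => sq_nonneg _))
    (Finset.sum_nonneg fun _ _ => sq_nonneg _)

theorem coordSqDist_le {β : ℝ} (hβ : 0 < β) (hβ' : β < 1 / 2) (S : Finset ℤ)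
    (S' : Finset (ℤˣ × ℤ × (ℤ → ℤ))) (u v : ZwrZ) : coordSqDist β S S' u v ≤
      (2 + 2 * ∑' r : ℤ, (rampWeight β (r + 1) - rampWeight β r) ^ 2) * dist u v ^ 2 := by
  have h1 := posInt_sub_sq_le u v
  have h2 := sum_lampInt_sub_sq_le S u v
  have h3 := sum_halfLineCoord_sub_sq_le hβ hβ' S' u v
  unfold coordSqDist
  linarith

/-- For every `α < 2 / 3` some Lipschitz map from `ℤ ≀ ℤ` to a Hilbert space, here given by the
squared distances of its finite-dimensional projections, has compression exponent at least `α`. -/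
theorem exists_rpow_dist_le {α : ℝ} (hα : 0 < α) (hα' : α < 2 / 3) :
    ∃ β : ℝ, 0 < β ∧ β < 1 / 2 ∧ ∀ u v : ZwrZ, ∃ S S',
      dist u v ^ (2 * α) ≤ 392 * coordSqDist β S S' u v := by
  have h1 : 1 / 2 ≤ max α (1 / 2) := le_max_right _ _
  have h2 : max α (1 / 2) < 2 / 3 := max_lt hα' (by norm_num)
  -- Raising the exponent to at least 1/2 makes β positive. Nonzero distances are at least 1, so the
  -- bound for the larger exponent implies the one for α.
  refine ⟨(3 * max α (1 / 2) - 1) / 2, by linarith, by linarith, fun u v => ?_⟩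
  by_cases huv : u = v
  · subst huv
    refine ⟨∅, ∅, ?_⟩
    rw [dist_self, Real.zero_rpow (by linarith)]
    exact mul_nonneg (by norm_num) (coordSqDist_nonneg _ _ _ _ _)
  · obtain ⟨S, S', h⟩ := exists_rpow_dist_le_of_half_le h1 h2 huv
    refine ⟨S, S', le_trans ?_ h⟩
    refine Real.rpow_le_rpow_of_exponent_le (one_le_dist_of_ne huv) ?_
    linarith [le_max_left α (1 / 2)]

/-! ### Transfer of Markov type 2 through the embedding -/

section WeightedSums

variable {ι : Type*} [Fintype ι] {w : ι → ℝ} {a : Matrix ι ι ℝ} [DecidableEq ι]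

theorem sum_pow_mul_sum_sub_sq_le {I : Type*} (hw : ∀ i, 0 ≤ w i) (ha : ∀ i j, 0 ≤ a i j)
    (hrow : ∀ i, ∑ j, a i j = 1) (hrev : ∀ i j, w i * a i j = w j * a j i)
    (F : I → ι → ℝ) (S : Finset I) (t : ℕ) :
    ∑ i, ∑ j, w i * (a ^ t) i j * ∑ s ∈ S, (F s i - F s j) ^ 2 ≤
      t * ∑ i, ∑ j, w i * a i j * ∑ s ∈ S, (F s i - F s j) ^ 2 := by
  have hswap : ∀ b : Matrix ι ι ℝ, ∑ i, ∑ j, w i * b i j * ∑ s ∈ S, (F s i - F s j) ^ 2 =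
      ∑ s ∈ S, ∑ i, ∑ j, w i * b i j * (F s i - F s j) ^ 2 := by
    intro b
    simp only [Finset.mul_sum]
    calc _ = ∑ i, ∑ s ∈ S, ∑ j, w i * b i j * (F s i - F s j) ^ 2 :=
          Finset.sum_congr rfl fun i _ => Finset.sum_comm
      _ = _ := Finset.sum_comm
  rw [hswap, hswap, Finset.mul_sum]
  exact Finset.sum_le_sum fun s _ => sum_pow_mul_sub_sq_le hw ha hrow hrev (F s) t

theorem sum_pow_mul_coordSqDist_le (hw : ∀ i, 0 ≤ w i) (ha : ∀ i j, 0 ≤ a i j)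
    (hrow : ∀ i, ∑ j, a i j = 1) (hrev : ∀ i j, w i * a i j = w j * a j i) (f : ι → ZwrZ)
    (β : ℝ) (S : Finset ℤ) (S' : Finset (ℤˣ × ℤ × (ℤ → ℤ))) (t : ℕ) :
    ∑ i, ∑ j, w i * (a ^ t) i j * coordSqDist β S S' (f i) (f j) ≤
      t * ∑ i, ∑ j, w i * a i j * coordSqDist β S S' (f i) (f j) := by
  have h1 := sum_pow_mul_sub_sq_le hw ha hrow hrev (fun i => (posInt (f i) : ℝ)) t
  have h2 := sum_pow_mul_sum_sub_sq_le hw ha hrow hrev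
    (fun z i => (lampInt (f i) z : ℝ)) S t
  have h3 := sum_pow_mul_sum_sub_sq_le hw ha hrow hrev
    (fun s i => halfLineCoord β s (f i)) S' t
  simp only [coordSqDist, mul_add, Finset.sum_add_distrib]
  linarith

end WeightedSums

theorem IsStationaryReversibleMarkovChain.integral_rpow_dist_le {β p A B D : ℝ} (hβ : 0 < β)
    (hβ' : β < 1 / 2) (hp : 0 < p) (hp' : p ≤ 2) (hA : 0 ≤ A)
    (hAβ : 2 + 2 * ∑' r : ℤ, (rampWeight β (r + 1) - rampWeight β r) ^ 2 ≤ A) (hB : 0 ≤ B)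
    (hβp : ∀ u v : ZwrZ, ∃ S S', dist u v ^ p ≤ B * coordSqDist β S S' u v)
    {Ω : Type*} [MeasurableSpace Ω] {P : Measure Ω} [IsProbabilityMeasure P]
    {n : ℕ} {a : Matrix (Fin n) (Fin n) ℝ} {Z : ℕ → Ω → Fin n} (f : Fin n → ZwrZ)
    (h : IsStationaryReversibleMarkovChain P a Z)
    (hD' : ∀ᵐ ω ∂P, dist (f (Z 0 ω)) (f (Z 1 ω)) ≤ D) (t : ℕ) :
    ∫ ω, dist (f (Z t ω)) (f (Z 0 ω)) ^ p ∂P ≤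
      B * A * D ^ (2 - p) * t * ∫ ω, dist (f (Z 1 ω)) (f (Z 0 ω)) ^ p ∂P := by
  classical
  -- The coordinates needed depend on the pair of points; there are finitely many pairs, so the
  -- union of the index sets serves all of them.
  choose S S' hS using fun i j => hβp (f i) (f j)
  set T := Finset.univ.biUnion fun i => Finset.univ.biUnion fun j => S i j with hT
  set T' := Finset.univ.biUnion fun i => Finset.univ.biUnion fun j => S' i j with hT'
  have hdist : ∀ i j, dist (f i) (f j) ^ p ≤ B * coordSqDist β T T' (f i) (f j) := by
    intro i j
    refine (hS i j).trans (mul_le_mul_of_nonneg_left (coordSqDist_mono ?_ ?_ _ _) hB)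
    · exact (Finset.subset_biUnion_of_mem (fun j => S i j) (Finset.mem_univ j)).trans
        (Finset.subset_biUnion_of_mem (fun i => Finset.univ.biUnion fun j => S i j)
          (Finset.mem_univ i))
    · exact (Finset.subset_biUnion_of_mem (fun j => S' i j) (Finset.mem_univ j)).trans
        (Finset.subset_biUnion_of_mem (fun i => Finset.univ.biUnion fun j => S' i j)
          (Finset.mem_univ i))
  rw [h.integral_pair t fun i j => dist (f i) (f j) ^ p,
    h.integral_pair 1 fun i j => dist (f i) (f j) ^ p, pow_one]
  set w : Fin n → ℝ := fun i => P.real {ω | Z 0 ω = i} with hwdef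
  have hw : ∀ i, 0 ≤ w i := fun i => measureReal_nonneg
  have hstep : ∀ i j, w i * a i j * (B * coordSqDist β T T' (f i) (f j)) ≤
      B * A * D ^ (2 - p) * (w i * a i j * dist (f j) (f i) ^ p) := by
    intro i j
    by_cases hij : w i * a i j = 0
    · simp [hij]
    · have hd := h.of_ae (R := fun i j => dist (f i) (f j) ≤ D) hD' i j hij
      -- The only use of bounded increments: the square is traded for the `p`-th power at the price
      -- D^(2-p).
      have hd2 : dist (f i) (f j) ^ 2 ≤ D ^ (2 - p) * dist (f i) (f j) ^ p := by
        rcases (dist_nonneg (x := f i) (y := f j)).eq_or_lt' with h0 | h0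
        · rw [h0, Real.zero_rpow hp.ne']; simp
        · have : dist (f i) (f j) ^ 2 = dist (f i) (f j) ^ (2 - p) * dist (f i) (f j) ^ p := by
            rw [← Real.rpow_add h0, ← Real.rpow_natCast]; norm_num
          rw [this]
          gcongr
      have h1 : coordSqDist β T T' (f i) (f j) ≤ A * (D ^ (2 - p) * dist (f i) (f j) ^ p) :=
        (coordSqDist_le hβ hβ' T T' _ _).trans (by gcongr)
      have h2 : 0 ≤ w i * a i j := mul_nonneg (hw i) (h.nonneg i j)
      rw [dist_comm (f j)]
      calc w i * a i j * (B * coordSqDist β T T' (f i) (f j))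
          ≤ w i * a i j * (B * (A * (D ^ (2 - p) * dist (f i) (f j) ^ p))) := by gcongr
        _ = _ := by ring
  calc ∑ i, ∑ j, w i * (a ^ t) i j * dist (f j) (f i) ^ p
      ≤ ∑ i, ∑ j, B * (w i * (a ^ t) i j * coordSqDist β T T' (f i) (f j)) := by
        refine Finset.sum_le_sum fun i _ => Finset.sum_le_sum fun j _ => ?_
        rw [dist_comm]
        have := mul_le_mul_of_nonneg_left (hdist i j)
          (mul_nonneg (hw i) (pow_apply_nonneg h.nonneg t i j))
        linarith
    _ = B * ∑ i, ∑ j, w i * (a ^ t) i j * coordSqDist β T T' (f i) (f j) := by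
        simp only [Finset.mul_sum]
    _ ≤ B * (t * ∑ i, ∑ j, w i * a i j * coordSqDist β T T' (f i) (f j)) := by
        gcongr
        exact sum_pow_mul_coordSqDist_le hw h.nonneg h.row_sum h.reversible f β T T' t
    _ = t * ∑ i, ∑ j, w i * a i j * (B * coordSqDist β T T' (f i) (f j)) := by
        simp only [Finset.mul_sum]
        exact Finset.sum_congr rfl fun i _ => Finset.sum_congr rfl fun j _ => by ring
    _ ≤ t * ∑ i, ∑ j, B * A * D ^ (2 - p) * (w i * a i j * dist (f j) (f i) ^ p) := by
        refine mul_le_mul_of_nonneg_left ?_ t.cast_nonneg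
        exact Finset.sum_le_sum fun i _ => Finset.sum_le_sum fun j _ => hstep i j
    _ = _ := by
        simp only [← Finset.mul_sum]; ring

theorem exists_boundedIncrementMarkovType {α : ℝ} (hα : 0 < α) (hα' : α < 2 / 3) :
    ∃ C : ℝ, 0 < C ∧ ∀ D : ℝ, 0 < D →
      HasBoundedIncrementMarkovTypeWith ZwrZ D (2 * α) (C * D ^ ((1 - α) / α)) := by
  obtain ⟨β, hβ, hβ', hE⟩ := exists_rpow_dist_le hα hα'
  set A := 2 + 2 * ∑' r : ℤ, (rampWeight β (r + 1) - rampWeight β r) ^ 2 with hA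
  have hA0 : 0 < A := by
    have : 0 ≤ ∑' r : ℤ, (rampWeight β (r + 1) - rampWeight β r) ^ 2 :=
      tsum_nonneg fun _ => sq_nonneg _
    linarith
  -- The constant is chosen so that its power 2α is 392 A; the exponent (1 - α)/α of `D` becomes 2 -
  -- 2α.
  refine ⟨(392 * A) ^ (2 * α)⁻¹, by positivity, fun D hD Ω _ P _ n a Z f hZ hZD t => ?_⟩
  have hK : ((392 * A) ^ (2 * α)⁻¹ * D ^ ((1 - α) / α)) ^ (2 * α) =
      392 * A * D ^ (2 - 2 * α) := by
    rw [Real.mul_rpow (by positivity) (by positivity), Real.rpow_inv_rpow (by positivity)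
      (by positivity), ← Real.rpow_mul hD.le]
    congr 2
    field_simp
  rw [hK]
  exact hZ.integral_rpow_dist_le hβ hβ' (by linarith) (by linarith) hA0.le le_rfl (by norm_num)
    hE f hZD t

theorem hasEdgeMarkovType_cayleyZwrZ {p : ℝ} (hp : 0 < p) (hp' : p < 4 / 3) :
    HasEdgeMarkovType cayleyZwrZ p := by
  obtain ⟨C, hC, h⟩ := exists_boundedIncrementMarkovType (α := p / 2) (by linarith) (by linarith)
  refine ⟨C, hC, fun Ω _ P _ n a Z f hZ hadj t => ?_⟩
  have := h 1 one_pos Ω P n a Z f hZ (hadj.mono fun ω hω => ?_) t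
  · rwa [Real.one_rpow, mul_one, mul_div_cancel₀ p two_ne_zero] at this
  · change ((cayleyZwrZ.dist _ _ : ℕ) : ℝ) ≤ 1
    rw [SimpleGraph.dist_eq_one_iff_adj.2 hω, Nat.cast_one]

theorem mainTheorem11 :
    (∀ α : ℝ, 0 < α → α < 2 / 3 → ∃ C : ℝ, 0 < C ∧ ∀ D : ℝ, 0 < D →
      HasBoundedIncrementMarkovTypeWith ZwrZ D (2 * α) (C * D ^ ((1 - α) / α))) ∧
    (∀ p : ℝ, 0 < p → p < 4 / 3 → HasEdgeMarkovType cayleyZwrZ p) ∧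
    (∀ p : ℝ, 1 < p → ¬ HasEnfloType ZwrZ p) :=
  ⟨fun _ h h' => exists_boundedIncrementMarkovType h h',
    fun _ h h' => hasEdgeMarkovType_cayleyZwrZ h h', fun _ h => not_hasEnfloType_ZwrZ h⟩
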